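/- **Setting.** Let $\mathbf p=(\mathbf p(k))_{k\ge 0}$ be a probability distribution on $\mathbb N=\{0,1,2,\dots\}$ with $\mathbf p(0)+\mathbf p(1)<1$ and $\sum_k k\,\mathbf p(k)<\infty$, and let $\mathbf q:\mathbb N\to[0,1]$ be a mark function with $\mathbf p(k)\mathbf q(k)>0$ for some $k$. Set $\mathbf p_0(k,1)=\mathbf p(k)\mathbf q(k)$ and $\mathbf p_0(k,0)=\mathbf p(k)(1-\mathbf q(k))$. Let $\mathbb P$ (with expectation $\mathbb E$) be the law, on the space $\mathbb T^*$ of marked ordered rooted trees, of the marked Galton–Watson tree with reproduction-marking law $\mathbf p_0$: independently for every individual, it has $k$ children and mark $\eta\in\{0,1\}$ with probability $\mathbf p_0(k,\eta)$. Let $Z_n$ be the number of individuals of generation $n$, let $M_n$ be the number of marked individuals in generations $0,\dots,n-1$ (so $M_0=0$), and let $\mathscr F_n$ be the $\sigma$-field generated by the tree up to generation $n$ and the marks up to generation $n-1$. Let $H_0(x)=1$ and $H_\ell(x)=\frac1{\ell!}\prod_{j=0}^{\ell-1}(x-j)$ for $\ell\ge1$, and let $$\psi(t)=\mathbb E\bigl[\mathbf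 1_{\{M_1=0\}}t^{Z_1}\bigr],\qquad \tilde r=\min\{j\ge 0:\ \mathbf p(j)(1-\mathbf q(j))>0\}.$$ **Theorem.** Assume $\tilde r=0$, i.e. $\mathbf p(0)(1-\mathbf q(0))>0$. Let $\ell\in\mathbb N$ be such that $\sum_k k^\ell\mathbf p(k)<\infty$, and suppose that $\mathbf p(k)(1-\mathbf q(k))>0$ for some $k\ge\min(\ell,2)$ (this is automatic for $\ell=0$). Let $t\in(0,1]$. Then: 1. $\psi$ has a smallest fixed point $\tilde\kappa$ in $(0,1]$, and $0<\tilde\kappa<1$; $\psi$ is differentiable at $\tilde\kappa$, and $\psi'(\tilde\kappa)>0$ if $\ell>0$. 2. The variables $H_\ell(Z_m)\mathbf 1_{\{M_m=0\}}t^{Z_m}$, $m\ge0$, are integrable, and their expectations are positive for all large $m$. 3. Set $$B_n=\begin{cases}\tilde\kappa^{\,Z_n-1}\,\mathbf 1_{\{M_n=0\}} & \text{if }\ell=0,\\[4pt] \dfrac{Z_n\,\tilde\kappa^{\,Z_n-1}}{\psi'(\tilde\kappa)^{n}}\,\mathbf 1_{\{M_n=0\}} & \text{if }\ell>0.\end{cases}$$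 Then $(B_n)_{n\ge0}$ is an $(\mathscr F_n)$-martingale under $\mathbb P$, and for every $n\in\mathbb N$ and every $\Lambda_n\in\mathscr F_n$, $$\lim_{p\to+\infty}\frac{\mathbb E\bigl[\mathbf 1_{\Lambda_n}H_\ell(Z_{n+p})\mathbf 1_{\{M_{n+p}=0\}}t^{Z_{n+p}}\bigr]}{\mathbb E\bigl[H_\ell(Z_{n+p})\mathbf 1_{\{M_{n+p}=0\}}t^{Z_{n+p}}\bigr]}=\mathbb E\bigl[\mathbf 1_{\Lambda_n}B_n\bigr].$$ -/

import Mathlib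

open MeasureTheory ProbabilityTheory Filter Topology Set
open scoped ENNReal

/-- A marked ordered rooted tree in Neveu's formalism. Vertices are finite words over the positive
integers and the child `uj` of `u` is `u ++ [j]`. The marks `η_u ∈ {0,1}` are recorded by the set of
marked vertices. -/
@[ext]
structure MarkedTree where
  nodes : Set (List ℕ+)
  root_mem : [] ∈ nodes
  parent_mem : ∀ u (j : ℕ+), u ++ [j] ∈ nodes → u ∈ nodes
  offspring : ∀ u ∈ nodes, ∃ k : ℕ, ∀ i : ℕ+, u ++ [i] ∈ nodes ↔ (i : ℕ) ≤ k
  marked : Set (List ℕ+)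
  marked_subset : marked ⊆ nodes

namespace MarkedTree

/-- The number of children `k_u` of `u`. -/
noncomputable def numChildren (τ : MarkedTree) (u : List ℕ+) : ℕ :=
  {i : ℕ+ | u ++ [i] ∈ τ.nodes}.ncard

/-- The restriction to generations `≤ h`, in which the vertices of generation `h` carry no mark. -/
def restr (h : ℕ) (τ : MarkedTree) : MarkedTree where
  nodes := {u ∈ τ.nodes | u.length ≤ h}
  root_mem := ⟨τ.root_mem, by simp⟩
  parent_mem := fun u j hu => by
    refine ⟨τ.parent_mem u j hu.1, ?_⟩
    have := hu.2
    simp only [List.length_append, List.length_singleton] at this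
    omega
  offspring := fun u hu => by
    obtain ⟨k, hk⟩ := τ.offspring u hu.1
    by_cases hl : u.length + 1 ≤ h
    · exact ⟨k, fun i => by simp [hk i, hl]⟩
    · exact ⟨0, fun i => by simp [hl]⟩
  marked := {u ∈ τ.marked | u.length < h}
  marked_subset := fun _ hu => ⟨τ.marked_subset hu.1, hu.2.le⟩

/-- `Z_n`, the size of generation `n`. -/
noncomputable def genSize (n : ℕ) (τ : MarkedTree) : ℕ :=
  {u ∈ τ.nodes | u.length = n}.ncard

/-- `M_n`, the number of marked vertices in the generations `0, …, n - 1`. -/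
noncomputable def numMarks (n : ℕ) (τ : MarkedTree) : ℕ :=
  {u ∈ τ.marked | u.length < n}.ncard

/-- The σ-field generated by the events "`u` is a vertex" and "`u` is a marked vertex". -/
instance : MeasurableSpace MarkedTree :=
  MeasurableSpace.generateFrom
    ({S | ∃ u, S = {τ | u ∈ τ.nodes}} ∪ {S | ∃ u, S = {τ | u ∈ τ.marked}})

lemma measurableSet_mem_nodes (u : List ℕ+) : MeasurableSet {τ : MarkedTree | u ∈ τ.nodes} :=
  MeasurableSpace.measurableSet_generateFrom (Or.inl ⟨u, rfl⟩)

lemma measurableSet_mem_marked (u : List ℕ+) : MeasurableSet {τ : MarkedTree | u ∈ τ.marked} :=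
  MeasurableSpace.measurableSet_generateFrom (Or.inr ⟨u, rfl⟩)

lemma measurable_of_mem {Ω : Type*} [MeasurableSpace Ω] {f : Ω → MarkedTree}
    (h₁ : ∀ u, MeasurableSet {ω | u ∈ (f ω).nodes})
    (h₂ : ∀ u, MeasurableSet {ω | u ∈ (f ω).marked}) : Measurable f := by
  apply measurable_generateFrom
  rintro _ (⟨u, rfl⟩ | ⟨u, rfl⟩)
  · exact h₁ u
  · exact h₂ u

lemma measurable_restr (h : ℕ) : Measurable (restr h) := by
  apply measurable_of_mem
  · intro u
    exact (measurableSet_mem_nodes u).inter (MeasurableSet.const (u.length ≤ h))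
  · intro u
    exact (measurableSet_mem_marked u).inter (MeasurableSet.const (u.length < h))

lemma restr_restr {m n : ℕ} (h : m ≤ n) (τ : MarkedTree) : restr m (restr n τ) = restr m τ := by
  ext u
  · simp only [restr, mem_ofPred_eq]
    constructor
    · rintro ⟨⟨h1, _⟩, h2⟩
      exact ⟨h1, h2⟩
    · rintro ⟨h1, h2⟩
      exact ⟨⟨h1, h2.trans h⟩, h2⟩
  · simp only [restr, mem_ofPred_eq]
    constructor
    · rintro ⟨⟨h1, _⟩, h2⟩
      exact ⟨h1, h2⟩
    · rintro ⟨h1, h2⟩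
      exact ⟨⟨h1, h2.trans_le h⟩, h2⟩

/-- The filtration `(ℱ_n)`: `ℱ_n` is the σ-field generated by the restriction map `restr n`. -/
def treeFiltration : Filtration ℕ (inferInstance : MeasurableSpace MarkedTree) where
  seq := fun n => MeasurableSpace.comap (restr n) inferInstance
  mono' := by
    intro m n hmn
    rintro _ ⟨S, hS, rfl⟩
    refine ⟨restr m ⁻¹' S, measurable_restr m hS, ?_⟩
    ext τ
    simp [restr_restr hmn]
  le' := fun n => (measurable_restr n).comap_le

/-- The marked tree in which every vertex `u` has `(ω u).1` children and is marked if and only if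
`(ω u).2 = true`. -/
def ofOffspring (ω : List ℕ+ → ℕ × Bool) : MarkedTree where
  nodes := {u | ∀ v (i : ℕ+), v ++ [i] <+: u → (i : ℕ) ≤ (ω v).1}
  root_mem := fun v i h => by simp at h
  parent_mem := fun u j hu v i h => hu v i (h.trans (List.prefix_append u [j]))
  offspring := fun u hu => by
    refine ⟨(ω u).1, fun i => ⟨fun h => h u i (List.prefix_refl _), fun h v j hv => ?_⟩⟩
    rw [List.prefix_concat_iff] at hv
    rcases hv with hv | hv
    · obtain ⟨rfl, h2⟩ := List.append_inj' hv rfl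
      simp only [List.cons.injEq, and_true] at h2
      exact h2 ▸ h
    · exact hu v j hv
  marked := {u | (∀ v (i : ℕ+), v ++ [i] <+: u → (i : ℕ) ≤ (ω v).1) ∧ (ω u).2 = true}
  marked_subset := fun _ hu => hu.1

lemma measurable_ofOffspring : Measurable ofOffspring := by
  have h1 : ∀ u : List ℕ+, MeasurableSet {ω : List ℕ+ → ℕ × Bool |
      ∀ v (i : ℕ+), v ++ [i] <+: u → (i : ℕ) ≤ (ω v).1} := by
    intro u
    simp only [ofPred_forall]
    refine MeasurableSet.iInter fun v => MeasurableSet.iInter fun i => MeasurableSet.iInter fun _ => ?_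
    exact measurableSet_le measurable_const (measurable_fst.comp (measurable_pi_apply v))
  apply measurable_of_mem
  · exact h1
  · intro u
    exact (h1 u).inter
      ((measurable_snd.comp (measurable_pi_apply u)) (measurableSet_singleton true))

/-- The law `ℙ_{p₀}` of the marked Galton–Watson tree with reproduction-marking law `p₀` on
`ℕ × {0,1}`: all pairs (number of children, mark) are drawn independently with law `p₀`. -/
noncomputable def mgwLaw (p₀ : PMF (ℕ × Bool)) : Measure MarkedTree :=
  (Measure.infinitePi fun _ : List ℕ+ => p₀.toMeasure).map ofOffspring

instance (p₀ : PMF (ℕ × Bool)) : IsProbabilityMeasure (mgwLaw p₀) :=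
  Measure.isProbabilityMeasure_map measurable_ofOffspring.aemeasurable

lemma append_mem_ofOffspring {ω : List ℕ+ → ℕ × Bool} {u : List ℕ+} {i : ℕ+} :
    u ++ [i] ∈ (ofOffspring ω).nodes ↔ u ∈ (ofOffspring ω).nodes ∧ (i : ℕ) ≤ (ω u).1 := by
  constructor
  · intro h
    exact ⟨(ofOffspring ω).parent_mem u i h, h u i (List.prefix_refl _)⟩
  · rintro ⟨hu, hi⟩ v j hv
    rw [List.prefix_concat_iff] at hv
    rcases hv with hv | hv
    · obtain ⟨rfl, h2⟩ := List.append_inj' hv rfl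
      simp only [List.cons.injEq, and_true] at h2
      exact h2 ▸ hi
    · exact hu v j hv

lemma ncard_pnat_le (k : ℕ) : {i : ℕ+ | (i : ℕ) ≤ k}.ncard = k := by
  have h : ((fun i : ℕ+ => (i : ℕ)) '' {i : ℕ+ | (i : ℕ) ≤ k}) = ↑(Finset.Icc 1 k) := by
    ext x
    simp only [mem_image, mem_ofPred_eq, Finset.coe_Icc, mem_Icc]
    constructor
    · rintro ⟨i, hi, rfl⟩
      exact ⟨i.2, hi⟩
    · rintro ⟨h1, h2⟩
      exact ⟨⟨x, h1⟩, h2, rfl⟩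
  rw [← Set.ncard_image_of_injective _ PNat.coe_injective]
  erw [h]
  rw [Set.ncard_coe_finset]
  simp

lemma append_mem_iff (τ : MarkedTree) {u : List ℕ+} (hu : u ∈ τ.nodes) (i : ℕ+) :
    u ++ [i] ∈ τ.nodes ↔ (i : ℕ) ≤ τ.numChildren u := by
  obtain ⟨k, hk⟩ := τ.offspring u hu
  have : τ.numChildren u = k := by
    unfold numChildren
    simp only [hk]
    exact ncard_pnat_le k
  rw [this, hk]

lemma finite_nodes_eq (τ : MarkedTree) (n : ℕ) : {u ∈ τ.nodes | u.length = n}.Finite := by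
  induction n with
  | zero =>
    refine (Set.finite_singleton []).subset ?_
    rintro u ⟨_, hu⟩
    exact List.length_eq_zero_iff.1 hu
  | succ n ih =>
    refine (ih.biUnion (t := fun u => (fun i : ℕ+ => u ++ [i]) '' {i | (i : ℕ) ≤ τ.numChildren u})
      fun u _ => ?_).subset ?_
    · refine Set.Finite.image _ ?_
      exact (Set.finite_Iic (τ.numChildren u)).preimage PNat.coe_injective.injOn
    · rintro u ⟨h1, h2⟩
      rcases List.eq_nil_or_concat u with rfl | ⟨v, i, rfl⟩
      · simp at h2
      · rw [List.concat_eq_append] at h1 h2 ⊢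
        have hv := τ.parent_mem v i h1
        simp only [mem_iUnion]
        refine ⟨v, ⟨hv, by simpa using h2⟩, i, (τ.append_mem_iff hv i).1 h1, rfl⟩

lemma finite_nodes_lt (τ : MarkedTree) (h : ℕ) : {u ∈ τ.nodes | u.length < h}.Finite := by
  refine ((Set.finite_Iio h).biUnion fun n _ => τ.finite_nodes_eq n).subset ?_
  rintro u ⟨h1, h2⟩
  simp only [mem_iUnion]
  exact ⟨u.length, h2, h1, rfl⟩

open Classical in
lemma restr_ofOffspring_eq_iff (h : ℕ) (τ : MarkedTree) (ω : List ℕ+ → ℕ × Bool) :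
    restr h (ofOffspring ω) = restr h τ ↔
      ∀ u ∈ τ.nodes, u.length < h → ω u = (τ.numChildren u, decide (u ∈ τ.marked)) := by
  have key : restr h (ofOffspring ω) = restr h τ ↔
      (∀ u, u.length ≤ h → (u ∈ (ofOffspring ω).nodes ↔ u ∈ τ.nodes)) ∧
      (∀ u, u.length < h → (u ∈ (ofOffspring ω).marked ↔ u ∈ τ.marked)) := by
    rw [MarkedTree.ext_iff, Set.ext_iff, Set.ext_iff]
    simp only [restr, mem_ofPred_eq, and_congr_left_iff]
  rw [key]
  constructor
  · rintro ⟨h1, h2⟩ u hu hl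
    have hu' := (h1 u hl.le).2 hu
    have hk : ∀ i : ℕ+, (i : ℕ) ≤ τ.numChildren u ↔ (i : ℕ) ≤ (ω u).1 := by
      intro i
      rw [← τ.append_mem_iff hu, ← h1 _ (by simpa using hl), append_mem_ofOffspring]
      simp [hu']
    refine Prod.ext ?_ ?_
    · rw [← ncard_pnat_le (ω u).1, ← ncard_pnat_le (τ.numChildren u)]
      simp only [hk]
    · have : u ∈ (ofOffspring ω).marked ↔ (ω u).2 = true :=
        ⟨fun h => h.2, fun h => ⟨hu', h⟩⟩
      rw [Bool.eq_iff_iff, ← this, h2 u hl]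
      simp
  · intro H
    have h1 : ∀ u : List ℕ+, u.length ≤ h → (u ∈ (ofOffspring ω).nodes ↔ u ∈ τ.nodes) := by
      intro u
      induction u using List.reverseRecOn with
      | nil => intro _; simp [root_mem]
      | append_singleton u i ih =>
        intro hl
        have hl' : u.length < h := by simpa using hl
        rw [append_mem_ofOffspring, ih hl'.le]
        constructor
        · rintro ⟨hu, hi⟩
          rw [H u hu hl'] at hi
          exact (τ.append_mem_iff hu i).2 hi
        · intro hu
          have hu' := τ.parent_mem u i hu
          refine ⟨hu', ?_⟩
          rw [H u hu' hl']
          exact (τ.append_mem_iff hu' i).1 hu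
    refine ⟨h1, fun u hl => ?_⟩
    constructor
    · intro hu
      have hm : (ω u).2 = true := hu.2
      rw [H u ((h1 u hl.le).1 ((ofOffspring ω).marked_subset hu)) hl] at hm
      simpa using hm
    · intro hu
      refine ⟨(h1 u hl.le).2 (τ.marked_subset hu), ?_⟩
      rw [H u (τ.marked_subset hu) hl]
      simpa using hu

lemma measurableSet_restr_eq (h : ℕ) (τ : MarkedTree) :
    MeasurableSet {σ : MarkedTree | restr h σ = restr h τ} := by
  have : {σ : MarkedTree | restr h σ = restr h τ} =
      (⋂ u, {σ | u ∈ (restr h σ).nodes ↔ u ∈ (restr h τ).nodes}) ∩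
      (⋂ u, {σ | u ∈ (restr h σ).marked ↔ u ∈ (restr h τ).marked}) := by
    ext σ
    rw [mem_ofPred_eq, MarkedTree.ext_iff, Set.ext_iff, Set.ext_iff]
    simp
  rw [this]
  refine (MeasurableSet.iInter fun u => ?_).inter (MeasurableSet.iInter fun u => ?_)
  · exact (measurable_restr h (measurableSet_mem_nodes u)).iff (MeasurableSet.const _)
  · exact (measurable_restr h (measurableSet_mem_marked u)).iff (MeasurableSet.const _)

open Classical in
/-- The formula that characterizes the law of the marked Galton–Watson tree. -/
theorem mgwLaw_restr_eq (p₀ : PMF (ℕ × Bool)) (h : ℕ) (τ : MarkedTree) :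
    mgwLaw p₀ {σ | restr h σ = restr h τ} =
      ∏ u ∈ (τ.finite_nodes_lt h).toFinset, p₀ (τ.numChildren u, decide (u ∈ τ.marked)) := by
  rw [mgwLaw, Measure.map_apply measurable_ofOffspring (measurableSet_restr_eq h τ)]
  have : ofOffspring ⁻¹' {σ | restr h σ = restr h τ} =
      Set.pi ((τ.finite_nodes_lt h).toFinset : Set (List ℕ+))
        (fun u => {(τ.numChildren u, decide (u ∈ τ.marked))}) := by
    ext ω
    simp only [mem_preimage, mem_ofPred_eq, restr_ofOffspring_eq_iff, Set.mem_pi,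
      Set.Finite.coe_toFinset, mem_singleton_iff, and_imp]
  rw [this, Measure.infinitePi_pi _ (fun _ _ => measurableSet_singleton _)]
  refine Finset.prod_congr rfl fun u _ => ?_
  exact p₀.toMeasure_apply_singleton _ (measurableSet_singleton _)

end MarkedTree

/-- The reproduction-marking law with offspring distribution `p` and mark function `q`:
`p₀(k,1) = p(k) q(k)` and `p₀(k,0) = p(k) (1 - q(k))`. -/
noncomputable def markingLaw (p : PMF ℕ) (q : ℕ → unitInterval) : PMF (ℕ × Bool) :=
  ⟨fun x => p x.1 * ENNReal.ofReal (if x.2 then (q x.1 : ℝ) else 1 - q x.1), by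
    have h : ∑' x : ℕ × Bool,
        p x.1 * ENNReal.ofReal (if x.2 then (q x.1 : ℝ) else 1 - q x.1) = 1 := by
      rw [ENNReal.summable.tsum_prod' fun _ => ENNReal.summable, ← p.tsum_coe]
      congr 1
      ext k
      simp only [tsum_bool, Bool.false_eq_true, if_false, if_true]
      rw [← mul_add, ← ENNReal.ofReal_add (by linarith [(q k).2.2]) (q k).2.1]
      simp
    exact h ▸ ENNReal.summable.hasSum⟩

/-- The law `ℙ_{p,q}` of the marked Galton–Watson tree. -/
noncomputable def mgwMeasure (p : PMF ℕ) (q : ℕ → unitInterval) : Measure MarkedTree :=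
  MarkedTree.mgwLaw (markingLaw p q)

instance (p : PMF ℕ) (q : ℕ → unitInterval) : IsProbabilityMeasure (mgwMeasure p q) :=
  inferInstanceAs (IsProbabilityMeasure (MarkedTree.mgwLaw (markingLaw p q)))

open MarkedTree

/-- The Hilbert polynomial `H_ℓ(x) = x (x - 1) ⋯ (x - ℓ + 1) / ℓ!`, with `H_0 = 1`. -/
noncomputable def hilbertH (ℓ : ℕ) (x : ℝ) : ℝ :=
  (∏ j ∈ Finset.range ℓ, (x - j)) / (ℓ.factorial : ℝ)

/-- The penalization `H_ℓ(Z_m) 1_{M_m = 0} t^{Z_m}`. -/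
noncomputable def penalty (ℓ : ℕ) (t : ℝ) (m : ℕ) (τ : MarkedTree) : ℝ :=
  hilbertH ℓ (genSize m τ) * (if numMarks m τ = 0 then 1 else 0) * t ^ genSize m τ

/-- `ψ(t) = 𝔼[1_{M_1 = 0} t^{Z_1}]`. -/
noncomputable def psi (p : PMF ℕ) (q : ℕ → unitInterval) (t : ℝ) : ℝ :=
  ∫ τ, (if numMarks 1 τ = 0 then 1 else 0) * t ^ genSize 1 τ ∂(mgwMeasure p q)

/-- The positive fixed points of `ψ` in its domain `[0,1]`. -/
def psiFixedPoints (p : PMF ℕ) (q : ℕ → unitInterval) : Set ℝ :=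
  {x | x ∈ Ioc (0 : ℝ) 1 ∧ psi p q x = x}

/-- The smallest positive fixed point of `ψ`. -/
noncomputable def kappaTilde (p : PMF ℕ) (q : ℕ → unitInterval) : ℝ :=
  sInf (psiFixedPoints p q)

/-- The limit: `κ̃^{Z_n - 1} 1_{M_n = 0}` for `ℓ = 0` and
`Z_n κ̃^{Z_n - 1} ψ'(κ̃)^{-n} 1_{M_n = 0}` for `ℓ > 0`. The exponent `Z_n - 1` is an integer. -/
noncomputable def limitMartingale (p : PMF ℕ) (q : ℕ → unitInterval) (ℓ n : ℕ)
    (τ : MarkedTree) : ℝ :=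
  if ℓ = 0 then
    kappaTilde p q ^ ((genSize n τ : ℤ) - 1) * (if numMarks n τ = 0 then 1 else 0)
  else
    (genSize n τ : ℝ) * kappaTilde p q ^ ((genSize n τ : ℤ) - 1)
      / deriv (psi p q) (kappaTilde p q) ^ n * (if numMarks n τ = 0 then 1 else 0)

/-! The polynomial `H_ℓ` is a binomial coefficient, so `H_ℓ(Z) t ^ Z` is the coefficient of order
`ℓ` of `(t(1 + X)) ^ Z`. By the branching property (`setLIntegral_unmarkedCoeff_add`), conditioning
on `ℱ_n` replaces `Y₀ = t(1 + X)` at time `n + m` by its `m`-th iterate `Y_m` under `Y ↦ ∑ a_k Y ^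
k` at time `n`, where `a_k = p(k)(1 - q(k))`. With `c m k j = [X^j] Y_m ^ k`, the ratio in the
theorem becomes `𝔼[1_Λ 1_{M_n = 0} c m Z_n ℓ] / c (n + m) 1 ℓ`. If `c m k ℓ / c m 1 ℓ → φ k` with a
bound uniform in `k`, then dominated convergence handles the numerator and also gives `c (m + 1) 1 ℓ
/ c m 1 ℓ → μ = ∑ a_k φ k`. The limit is therefore `φ(Z_n) μ^{-n} 1_{M_n = 0}`
(`tendsto_setIntegral_penalty_div`).

To find `φ`: since marks occur, `ψ(1) < 1`, and the chord of `ψ` from `κ̃` to `1` has slope below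
`1`. This slope is a contraction constant, so the constant terms of `Y_m` tend to `κ̃`; it also
bounds `D = ψ'(κ̃)`. For `ℓ = 0` this gives `φ k = κ̃^{k-1}` and `μ = 1`. For `ℓ > 0`, `[X^ℓ] Y ^ k`
equals `k y_0^{k-1} y_ℓ` plus products of at least two coefficients of positive order below `ℓ`.
Such coefficients decay at any rate `β > D`, so the remainder is `O(β^{2m})` uniformly in `k`, while
`y_ℓ` is at least of order `α^m` for any `α < D`. As `0 < D < 1`, one can take `β² < α < D < β`; the
remainder is negligible, `φ k = k κ̃^{k-1}` and `μ = D` (`IsPgfIteration.tendsto_div_of_pos`).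

The martingale property comes for free: for `Λ ∈ ℱ_n`, the limits at times `n` and `n + 1` are
limits of the same sequence. -/

/-- Integrating a product of functions of distinct coordinates, part of which is the coefficient of
a product of random power series. -/
lemma lintegral_infinitePi_prod_mul_coeff_prod {ι α : Type*} [DecidableEq ι] [MeasurableSpace α]
    [DiscreteMeasurableSpace α] (ν : Measure α) [IsProbabilityMeasure ν] (T S : Finset ι)
    (hTS : Disjoint T S) (h : ι → α → ℝ≥0∞) (F : α → PowerSeries ℝ≥0∞) (j : ℕ) :
    ∫⁻ ω, (∏ u ∈ T, h u (ω u)) * PowerSeries.coeff j (∏ u ∈ S, F (ω u))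
        ∂(Measure.infinitePi fun _ : ι => ν) =
      (∏ u ∈ T, ∫⁻ x, h u x ∂ν) *
        PowerSeries.coeff j (∏ _u ∈ S, PowerSeries.mk fun i => ∫⁻ x, PowerSeries.coeff i (F x) ∂ν) := by
  have hprod : ∀ (U : Finset ι) (f : ι → α → ℝ≥0∞),
      ∫⁻ ω, ∏ u ∈ U, f u (ω u) ∂(Measure.infinitePi fun _ : ι => ν) = ∏ u ∈ U, ∫⁻ x, f u x ∂ν := by
    intro U f
    rw [lintegral_prod_eq_prod_lintegral_of_indepFun U (fun u (ω : ι → α) => f u (ω u))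
      (iIndepFun_infinitePi (X := f) fun _ => Measurable.of_discrete)
      fun u => (Measurable.of_discrete (f := f u)).comp (measurable_pi_apply u)]
    refine Finset.prod_congr rfl fun u _ => ?_
    exact (measurePreserving_eval_infinitePi (fun _ : ι => ν) u).lintegral_comp
      (f := f u) Measurable.of_discrete
  have hmeas : ∀ (U : Finset ι) (f : ι → α → ℝ≥0∞), Measurable fun ω : ι → α =>
      ∏ u ∈ U, f u (ω u) := fun U f =>
    Finset.measurable_prod _ fun u _ => Measurable.of_discrete.comp (measurable_pi_apply u)
  have hsplit : ∀ (l : ι →₀ ℕ) (ω : ι → α),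
      (∏ u ∈ T, h u (ω u)) * ∏ u ∈ S, PowerSeries.coeff (l u) (F (ω u)) =
        ∏ u ∈ T ∪ S, (if u ∈ T then h u (ω u) else PowerSeries.coeff (l u) (F (ω u))) := by
    intro l ω
    rw [Finset.prod_union hTS]
    congr 1
    · exact Finset.prod_congr rfl fun u hu => by rw [if_pos hu]
    · exact Finset.prod_congr rfl fun u hu => by
        rw [if_neg (Finset.disjoint_right.1 hTS hu)]
  -- Each way of distributing the order `j` over `S` yields a product over the distinct coordinates
  -- in `T ∪ S`, to which independence applies.
  simp only [PowerSeries.coeff_prod, Finset.mul_sum, hsplit]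
  rw [lintegral_finsetSum _ fun l _ => hmeas (T ∪ S)
    fun u x => if u ∈ T then h u x else PowerSeries.coeff (l u) (F x)]
  refine Finset.sum_congr rfl fun l _ => ?_
  rw [hprod (T ∪ S) fun u x => if u ∈ T then h u x else PowerSeries.coeff (l u) (F x),
    Finset.prod_union hTS]
  congr 1
  · exact Finset.prod_congr rfl fun u hu => by simp only [if_pos hu]
  · exact Finset.prod_congr rfl fun u hu => by
      simp only [if_neg (Finset.disjoint_right.1 hTS hu), PowerSeries.coeff_mk]

/-! ### Atoms of the filtration and the branching property. -/

namespace MarkedTree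

lemma genSize_restr {m n : ℕ} (h : m ≤ n) (τ : MarkedTree) :
    genSize m (restr n τ) = genSize m τ := by
  unfold genSize
  congr 1
  ext u
  simp only [restr, mem_ofPred_eq]
  constructor
  · rintro ⟨⟨h1, _⟩, h2⟩
    exact ⟨h1, h2⟩
  · rintro ⟨h1, h2⟩
    exact ⟨⟨h1, h2 ▸ h⟩, h2⟩

lemma numMarks_restr {m n : ℕ} (h : m ≤ n) (τ : MarkedTree) :
    numMarks m (restr n τ) = numMarks m τ := by
  unfold numMarks
  congr 1
  ext u
  simp only [restr, mem_ofPred_eq]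
  constructor
  · rintro ⟨⟨h1, _⟩, h2⟩
    exact ⟨h1, h2⟩
  · rintro ⟨h1, h2⟩
    exact ⟨⟨h1, h2.trans_le h⟩, h2⟩

lemma genSize_zero (τ : MarkedTree) : genSize 0 τ = 1 := by
  have : {u ∈ τ.nodes | u.length = 0} = {[]} := by
    ext u
    simp only [List.length_eq_zero_iff, mem_ofPred_eq, mem_singleton_iff]
    constructor
    · exact fun h => h.2
    · rintro rfl
      exact ⟨τ.root_mem, rfl⟩
  rw [genSize, this, Set.ncard_singleton]

lemma numMarks_zero (τ : MarkedTree) : numMarks 0 τ = 0 := by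
  simp [numMarks]

lemma genSize_eq_card (n : ℕ) (τ : MarkedTree) :
    genSize n τ = (τ.finite_nodes_eq n).toFinset.card :=
  Set.ncard_eq_toFinset_card _ _

lemma genSize_succ (n : ℕ) (τ : MarkedTree) :
    genSize (n + 1) τ = ∑ u ∈ (τ.finite_nodes_eq n).toFinset, τ.numChildren u := by
  classical
  rw [genSize_eq_card, Finset.card_eq_sum_card_fiberwise (f := List.dropLast)
    (t := (τ.finite_nodes_eq n).toFinset)]
  · refine Finset.sum_congr rfl fun u hu => ?_
    have hu' : u ∈ τ.nodes ∧ u.length = n := by simpa using hu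
    rw [numChildren, ← Set.ncard_coe_finset,
      ← Set.ncard_image_of_injective (f := fun i : ℕ+ => u ++ [i]) {i : ℕ+ | u ++ [i] ∈ τ.nodes}
        fun i j hij => by simpa using hij]
    congr 1
    ext v
    simp only [Finset.coe_filter, Set.Finite.mem_toFinset, mem_ofPred_eq, mem_image]
    constructor
    · rintro ⟨⟨h1, h2⟩, h3⟩
      rcases List.eq_nil_or_concat v with rfl | ⟨w, i, rfl⟩
      · simp at h2
      · rw [List.concat_eq_append] at h1 h2 h3 ⊢
        rw [List.dropLast_concat] at h3
        exact ⟨i, h3 ▸ h1, by rw [h3]⟩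
    · rintro ⟨i, hi, rfl⟩
      exact ⟨⟨hi, by simp [hu'.2]⟩, by simp⟩
  · intro v hv
    have hv' : v ∈ τ.nodes ∧ v.length = n + 1 := by simpa using hv
    obtain ⟨h1, h2⟩ := hv'
    rcases List.eq_nil_or_concat v with rfl | ⟨w, i, rfl⟩
    · simp at h2
    · rw [List.concat_eq_append] at h1 h2 ⊢
      have := τ.parent_mem w i h1
      simp only [List.length_append, List.length_singleton] at h2
      simpa [this] using h2

lemma numMarks_eq_zero_iff (n : ℕ) (τ : MarkedTree) :
    numMarks n τ = 0 ↔ ∀ u ∈ τ.nodes, u.length < n → u ∉ τ.marked := by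
  have hfin : {u ∈ τ.marked | u.length < n}.Finite :=
    (τ.finite_nodes_lt n).subset fun u hu => ⟨τ.marked_subset hu.1, hu.2⟩
  rw [numMarks, Set.ncard_eq_zero hfin, Set.eq_empty_iff_forall_notMem]
  constructor
  · exact fun h u _ hl hm => h u ⟨hm, hl⟩
  · exact fun h u hu => h u (τ.marked_subset hu.1) hu.2 hu.1

lemma numMarks_succ_eq_zero_iff (n : ℕ) (τ : MarkedTree) :
    numMarks (n + 1) τ = 0 ↔
      numMarks n τ = 0 ∧ ∀ u ∈ (τ.finite_nodes_eq n).toFinset, u ∉ τ.marked := by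
  simp only [numMarks_eq_zero_iff, Set.Finite.mem_toFinset, mem_ofPred_eq, and_imp]
  constructor
  · exact fun h => ⟨fun u hu hl => h u hu (by omega), fun u hu hl => h u hu (by omega)⟩
  · rintro ⟨h1, h2⟩ u hu hl
    rcases Nat.lt_succ_iff_lt_or_eq.1 hl with hl | hl
    · exact h1 u hu hl
    · exact h2 u hu hl

/-- A truncated tree is a pair of finite subsets of a countable set. Hence `ℱ_n` has countably many
atoms, and measurability and integrals can be checked atom by atom. -/
lemma countable_range_restr (n : ℕ) : (range (restr n)).Countable := by
  have h1 : ∀ τ : MarkedTree, (restr n τ).nodes.Finite := fun τ =>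
    (τ.finite_nodes_lt (n + 1)).subset fun u hu => ⟨hu.1, Nat.lt_succ_of_le hu.2⟩
  have h2 : ∀ τ : MarkedTree, (restr n τ).marked.Finite := fun τ =>
    (h1 τ).subset (restr n τ).marked_subset
  refine Set.MapsTo.countable_of_injOn (f := fun σ : MarkedTree => (σ.nodes, σ.marked))
    (t := {A : Set (List ℕ+) | A.Finite} ×ˢ {A : Set (List ℕ+) | A.Finite}) ?_ ?_ ?_
  · rintro _ ⟨τ, rfl⟩
    exact ⟨h1 τ, h2 τ⟩
  · rintro σ _ σ' _ h
    simp only [Prod.mk.injEq] at h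
    exact MarkedTree.ext h.1 h.2
  · exact Set.Countable.ofPred_finite.prod Set.Countable.ofPred_finite

lemma measurableSet_treeFiltration_atom (n : ℕ) (τ : MarkedTree) :
    MeasurableSet[treeFiltration n] {σ : MarkedTree | restr n σ = restr n τ} := by
  refine ⟨{σ | restr n σ = restr n τ}, measurableSet_restr_eq n τ, ?_⟩
  ext σ
  simp [restr_restr le_rfl]

lemma measurable_treeFiltration {α : Type*} [MeasurableSpace α] {n : ℕ} {f : MarkedTree → α}
    (hf : ∀ τ, f (restr n τ) = f τ) : Measurable[treeFiltration n] f := by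
  intro B _
  have : f ⁻¹' B = ⋃ σ ∈ range (restr n) ∩ f ⁻¹' B, {τ | restr n τ = σ} := by
    ext τ
    simp only [mem_preimage, mem_inter_iff, mem_range, mem_iUnion, mem_ofPred_eq, exists_prop]
    constructor
    · exact fun h => ⟨restr n τ, ⟨⟨τ, rfl⟩, by rwa [hf]⟩, rfl⟩
    · rintro ⟨σ, ⟨_, h⟩, rfl⟩
      rwa [hf] at h
  rw [this]
  refine MeasurableSet.biUnion ((countable_range_restr n).mono inter_subset_left) ?_
  rintro _ ⟨⟨τ, rfl⟩, _⟩
  exact measurableSet_treeFiltration_atom n τ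

/-- Two functions with equal integrals over the atoms of `ℱ_n` have equal integrals over the
events of `ℱ_n`. -/
lemma setLIntegral_eq_of_atoms {μ : Measure MarkedTree} {n : ℕ} {f g : MarkedTree → ℝ≥0∞}
    (h : ∀ τ, ∫⁻ σ in {σ | restr n σ = restr n τ}, f σ ∂μ =
      ∫⁻ σ in {σ | restr n σ = restr n τ}, g σ ∂μ)
    {Λ : Set MarkedTree} (hΛ : MeasurableSet[treeFiltration n] Λ) :
    ∫⁻ σ in Λ, f σ ∂μ = ∫⁻ σ in Λ, g σ ∂μ := by
  obtain ⟨S, _, rfl⟩ := hΛ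
  have : restr n ⁻¹' S = ⋃ ρ ∈ range (restr n) ∩ S, {τ | restr n τ = ρ} := by
    ext τ
    simp only [mem_preimage, mem_inter_iff, mem_range, mem_iUnion, mem_ofPred_eq, exists_prop]
    constructor
    · exact fun h => ⟨restr n τ, ⟨⟨τ, rfl⟩, h⟩, rfl⟩
    · rintro ⟨σ, ⟨_, h⟩, rfl⟩
      exact h
  have hc := (countable_range_restr n).mono (inter_subset_left (t := S))
  have hm : ∀ ρ ∈ range (restr n) ∩ S, MeasurableSet {τ | restr n τ = ρ} := by
    rintro _ ⟨⟨τ, rfl⟩, _⟩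
    exact measurableSet_restr_eq n τ
  have hd : (range (restr n) ∩ S).PairwiseDisjoint fun ρ => {τ | restr n τ = ρ} := by
    rintro ρ _ ρ' _ hne
    refine Set.disjoint_left.2 fun τ (h1 : _ = _) (h2 : _ = _) => hne (h1.symm.trans h2)
  rw [this, lintegral_biUnion hc hm hd, lintegral_biUnion hc hm hd]
  refine tsum_congr ?_
  rintro ⟨_, ⟨τ, rfl⟩, _⟩
  exact h τ

lemma numChildren_ofOffspring {ω : List ℕ+ → ℕ × Bool} {u : List ℕ+}
    (hu : u ∈ (ofOffspring ω).nodes) : (ofOffspring ω).numChildren u = (ω u).1 := by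
  unfold numChildren
  simp only [append_mem_ofOffspring, hu, true_and]
  exact ncard_pnat_le _

lemma mem_marked_ofOffspring {ω : List ℕ+ → ℕ × Bool} {u : List ℕ+}
    (hu : u ∈ (ofOffspring ω).nodes) : u ∈ (ofOffspring ω).marked ↔ (ω u).2 = true :=
  ⟨fun h => h.2, fun h => ⟨hu, h⟩⟩

/-- The coefficient of order `j` of `1_{M_n = 0} X ^ Z_n`. -/
noncomputable def unmarkedCoeff (X : PowerSeries ℝ≥0∞) (n j : ℕ) (τ : MarkedTree) : ℝ≥0∞ :=
  if numMarks n τ = 0 then PowerSeries.coeff j (X ^ genSize n τ) else 0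

/-- The generating function `∑ k, p₀(k, 0) X ^ k` of the number of children of an unmarked
individual, as an operation on power series. -/
noncomputable def pgfStep (p₀ : PMF (ℕ × Bool)) (X : PowerSeries ℝ≥0∞) : PowerSeries ℝ≥0∞ :=
  PowerSeries.mk fun j => ∑' k, p₀ (k, false) * PowerSeries.coeff j (X ^ k)

lemma measurable_treeFiltration_unmarkedCoeff (X : PowerSeries ℝ≥0∞) (n j : ℕ) :
    Measurable[treeFiltration n] (unmarkedCoeff X n j) :=
  measurable_treeFiltration fun τ => by
    simp only [unmarkedCoeff, genSize_restr le_rfl, numMarks_restr le_rfl]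

lemma measurable_unmarkedCoeff (X : PowerSeries ℝ≥0∞) (n j : ℕ) :
    Measurable (unmarkedCoeff X n j) :=
  (measurable_treeFiltration_unmarkedCoeff X n j).mono (treeFiltration.le n) le_rfl

lemma unmarkedCoeff_succ (X : PowerSeries ℝ≥0∞) (n j : ℕ) (τ : MarkedTree) :
    unmarkedCoeff X (n + 1) j τ = if numMarks n τ = 0 then
      PowerSeries.coeff j (∏ u ∈ (τ.finite_nodes_eq n).toFinset,
        open Classical in if u ∈ τ.marked then 0 else X ^ τ.numChildren u) else 0 := by
  classical
  unfold unmarkedCoeff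
  simp only [numMarks_succ_eq_zero_iff]
  by_cases h : numMarks n τ = 0
  · by_cases h' : ∀ u ∈ (τ.finite_nodes_eq n).toFinset, u ∉ τ.marked
    · rw [if_pos ⟨h, h'⟩, if_pos h, genSize_succ, ← Finset.prod_pow_eq_pow_sum]
      congr 1
      exact Finset.prod_congr rfl fun u hu => by rw [if_neg (h' u hu)]
    · rw [if_neg fun h'' => h' h''.2, if_pos h]
      push Not at h'
      obtain ⟨u, hu, hm⟩ := h'
      rw [Finset.prod_eq_zero hu (by rw [if_pos hm]), map_zero]
  · rw [if_neg fun h'' => h h''.1, if_neg h]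

lemma restr_eq_restr_iff_of_le {n : ℕ} {σ τ : MarkedTree} (h : restr n σ = restr n τ)
    {u : List ℕ+} (hu : u.length ≤ n) : u ∈ σ.nodes ↔ u ∈ τ.nodes := by
  have := congrArg (fun ρ => u ∈ ρ.nodes) h
  simpa [restr, hu] using this

/-- The atom constrains only the coordinates at vertices below generation `n`, whereas the
generation-`n` vertices, known on the atom, contribute independent random series `1_{unmarked} X ^
k`. Their coefficientwise mean is `pgfStep p₀ X`. -/
lemma setLIntegral_atom_unmarkedCoeff_succ (p₀ : PMF (ℕ × Bool)) (X : PowerSeries ℝ≥0∞)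
    (n j : ℕ) (τ : MarkedTree) :
    ∫⁻ σ in {σ | restr n σ = restr n τ}, unmarkedCoeff X (n + 1) j σ ∂(mgwLaw p₀) =
      ∫⁻ σ in {σ | restr n σ = restr n τ}, unmarkedCoeff (pgfStep p₀ X) n j σ ∂(mgwLaw p₀) := by
  classical
  have hA := measurableSet_restr_eq n τ
  set S := (τ.finite_nodes_eq n).toFinset with hS
  set T := (τ.finite_nodes_lt n).toFinset with hT
  have hM : ∀ σ, restr n σ = restr n τ → numMarks n σ = numMarks n τ := fun σ hσ => by
    rw [← numMarks_restr le_rfl σ, hσ, numMarks_restr le_rfl]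
  have hZ : ∀ σ, restr n σ = restr n τ → genSize n σ = genSize n τ := fun σ hσ => by
    rw [← genSize_restr le_rfl σ, hσ, genSize_restr le_rfl]
  have hR : ∫⁻ σ in {σ | restr n σ = restr n τ}, unmarkedCoeff (pgfStep p₀ X) n j σ ∂(mgwLaw p₀)
      = unmarkedCoeff (pgfStep p₀ X) n j τ * mgwLaw p₀ {σ | restr n σ = restr n τ} := by
    rw [setLIntegral_congr_fun (g := fun _ => unmarkedCoeff (pgfStep p₀ X) n j τ) hA
      fun σ hσ => by simp only [unmarkedCoeff, hM σ hσ, hZ σ hσ], setLIntegral_const]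
  rw [hR]
  by_cases h0 : numMarks n τ = 0
  swap
  · rw [setLIntegral_congr_fun (g := fun _ => 0) hA
      fun σ hσ => by simp only [unmarkedCoeff_succ, hM σ hσ, if_neg h0]]
    simp [unmarkedCoeff, h0]
  let v : List ℕ+ → ℕ × Bool := fun u => (τ.numChildren u, decide (u ∈ τ.marked))
  let F : ℕ × Bool → PowerSeries ℝ≥0∞ := fun x => if x.2 = true then 0 else X ^ x.1
  rw [← lintegral_indicator hA, mgwLaw,
    lintegral_map ((measurable_unmarkedCoeff X (n + 1) j).indicator hA) measurable_ofOffspring]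
  -- The indicator of the atom is itself a product of coordinate indicators over `T`, so the
  -- integrand has the factored form needed for independence.
  have hpt : ∀ ω, {σ | restr n σ = restr n τ}.indicator (unmarkedCoeff X (n + 1) j)
      (ofOffspring ω) = (∏ u ∈ T, (fun x => if x = v u then (1 : ℝ≥0∞) else 0) (ω u)) *
        PowerSeries.coeff j (∏ u ∈ S, F (ω u)) := by
    intro ω
    by_cases hω : restr n (ofOffspring ω) = restr n τ
    · rw [indicator_of_mem (s := {σ | restr n σ = restr n τ}) hω]
      have h1 := (restr_ofOffspring_eq_iff n τ ω).1 hω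
      rw [Finset.prod_eq_one, one_mul, unmarkedCoeff_succ, hM _ hω, if_pos h0]
      · have hnodes : ((ofOffspring ω).finite_nodes_eq n).toFinset = S := by
          ext u
          simp only [hS, Set.Finite.mem_toFinset, mem_ofPred_eq, and_congr_left_iff]
          exact fun hl => restr_eq_restr_iff_of_le hω hl.le
        rw [hnodes]
        congr 1
        refine Finset.prod_congr rfl fun u hu => ?_
        have hu' : u ∈ (ofOffspring ω).nodes := by
          rw [← hnodes] at hu
          simp only [Set.Finite.mem_toFinset, mem_ofPred_eq] at hu
          exact hu.1
        rw [numChildren_ofOffspring hu']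
        simp only [F, mem_marked_ofOffspring hu']
      · intro u hu
        simp only [hT, Set.Finite.mem_toFinset, mem_ofPred_eq] at hu
        exact if_pos (h1 u hu.1 hu.2)
    · rw [indicator_of_notMem (s := {σ | restr n σ = restr n τ}) hω]
      have h1 := mt (restr_ofOffspring_eq_iff n τ ω).2 hω
      push Not at h1
      obtain ⟨u, hu, hl, hne⟩ := h1
      rw [Finset.prod_eq_zero (i := u) (by simp [hT, hu, hl]) (if_neg hne), zero_mul]
  simp only [hpt]
  have hTS : Disjoint T S := by
    refine Finset.disjoint_left.2 fun u h1 h2 => ?_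
    simp only [hT, hS, Set.Finite.mem_toFinset, mem_ofPred_eq] at h1 h2
    omega
  rw [lintegral_infinitePi_prod_mul_coeff_prod p₀.toMeasure T S hTS
    (fun u x => if x = v u then (1 : ℝ≥0∞) else 0) F j]
  rw [← mgwLaw, mgwLaw_restr_eq, mul_comm]
  congr 1
  · rw [unmarkedCoeff, if_pos h0, Finset.prod_const, genSize_eq_card]
    congr 2
    ext i
    rw [PowerSeries.coeff_mk, pgfStep, PowerSeries.coeff_mk, lintegral_countable',
      ENNReal.summable.tsum_prod' fun _ => ENNReal.summable]
    refine tsum_congr fun k => ?_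
    simp [F, mul_comm, PMF.toMeasure_apply_singleton]
  · refine Finset.prod_congr rfl fun u _ => ?_
    rw [← PMF.toMeasure_apply_singleton p₀ _ (measurableSet_singleton _),
      ← lintegral_indicator_one (measurableSet_singleton _)]
    refine lintegral_congr fun x => ?_
    simp [indicator_apply, v]

lemma setLIntegral_unmarkedCoeff_succ (p₀ : PMF (ℕ × Bool)) (X : PowerSeries ℝ≥0∞) (n j : ℕ)
    {Λ : Set MarkedTree} (hΛ : MeasurableSet[treeFiltration n] Λ) :
    ∫⁻ σ in Λ, unmarkedCoeff X (n + 1) j σ ∂(mgwLaw p₀) =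
      ∫⁻ σ in Λ, unmarkedCoeff (pgfStep p₀ X) n j σ ∂(mgwLaw p₀) :=
  setLIntegral_eq_of_atoms (setLIntegral_atom_unmarkedCoeff_succ p₀ X n j) hΛ

/-- The branching property. -/
lemma setLIntegral_unmarkedCoeff_add (p₀ : PMF (ℕ × Bool)) (X : PowerSeries ℝ≥0∞) (n m j : ℕ)
    {Λ : Set MarkedTree} (hΛ : MeasurableSet[treeFiltration n] Λ) :
    ∫⁻ σ in Λ, unmarkedCoeff X (n + m) j σ ∂(mgwLaw p₀) =
      ∫⁻ σ in Λ, unmarkedCoeff ((pgfStep p₀)^[m] X) n j σ ∂(mgwLaw p₀) := by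
  induction m generalizing X with
  | zero => rfl
  | succ m ih =>
    rw [← add_assoc, setLIntegral_unmarkedCoeff_succ p₀ X (n + m) j
      (treeFiltration.mono (Nat.le_add_right n m) _ hΛ), ih, Function.iterate_succ_apply]

lemma lintegral_unmarkedCoeff (p₀ : PMF (ℕ × Bool)) (X : PowerSeries ℝ≥0∞) (m j : ℕ) :
    ∫⁻ σ, unmarkedCoeff X m j σ ∂(mgwLaw p₀) = PowerSeries.coeff j ((pgfStep p₀)^[m] X) := by
  have := setLIntegral_unmarkedCoeff_add p₀ X 0 m j (Λ := univ) MeasurableSet.univ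
  rw [zero_add, setLIntegral_univ, setLIntegral_univ] at this
  rw [this]
  simp [unmarkedCoeff, genSize_zero, numMarks_zero]

end MarkedTree

/-! ### Generating functions on the unit interval: fixed point, contraction, derivative. -/

section PowerSeriesOnUnitInterval

lemma sum_range_pow_eq_div {s : ℝ} (hs1 : s < 1) (k : ℕ) :
    ∑ i ∈ Finset.range k, s ^ i = (1 - s ^ k) / (1 - s) := by
  rw [eq_div_iff (by linarith), mul_comm, mul_neg_geom_sum]

/-- By convexity, the tangent slope of `x ^ k` at `s` is at most its chord slope from `s` to `1`;
concretely, `s ^ (k - 1)` is the smallest term of the geometric sum. -/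
lemma natCast_mul_pow_pred_le_div {s : ℝ} (hs0 : 0 ≤ s) (hs1 : s < 1) (k : ℕ) :
    k * s ^ (k - 1) ≤ (1 - s ^ k) / (1 - s) := by
  rw [← sum_range_pow_eq_div hs1]
  calc (k : ℝ) * s ^ (k - 1) = ∑ _i ∈ Finset.range k, s ^ (k - 1) := by simp
    _ ≤ _ := Finset.sum_le_sum fun i hi => pow_le_pow_of_le_one hs0 hs1.le
        (by have := Finset.mem_range.1 hi; omega)

lemma natCast_mul_pow_pred_le {s : ℝ} (hs0 : 0 ≤ s) (hs1 : s < 1) (k : ℕ) :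
    k * s ^ (k - 1) ≤ 1 / (1 - s) := by
  refine (natCast_mul_pow_pred_le_div hs0 hs1 k).trans ?_
  have : 0 < 1 - s := by linarith
  have := pow_nonneg hs0 k
  gcongr
  linarith

lemma abs_pow_sub_pow_le_div {x s : ℝ} (hx : x ∈ Icc (0 : ℝ) 1) (hs0 : 0 ≤ s) (hs1 : s < 1)
    (k : ℕ) : |x ^ k - s ^ k| ≤ (1 - s ^ k) / (1 - s) * |x - s| := by
  rw [← geom_sum₂_mul, abs_mul, abs_of_nonneg
    (Finset.sum_nonneg fun i _ => mul_nonneg (pow_nonneg hx.1 _) (pow_nonneg hs0 _))]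
  refine mul_le_mul_of_nonneg_right ?_ (abs_nonneg _)
  rw [← sum_range_pow_eq_div hs1, ← Finset.sum_range_reflect (fun i => s ^ i)]
  exact Finset.sum_le_sum fun i _ =>
    mul_le_of_le_one_left (pow_nonneg hs0 _) (pow_le_one₀ hx.1 hx.2)

variable {a : ℕ → ℝ} (ha : ∀ k, 0 ≤ a k) (hsum : Summable a)
include ha hsum

lemma summable_mul_of_le_of_nonneg {f : ℕ → ℝ} {C : ℝ} (hf0 : ∀ k, 0 ≤ f k) (hf : ∀ k, f k ≤ C) :
    Summable fun k => a k * f k :=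
  (hsum.mul_right C).of_nonneg_of_le (fun k => mul_nonneg (ha k) (hf0 k))
    fun k => mul_le_mul_of_nonneg_left (hf k) (ha k)

lemma summable_mul_pow {x : ℝ} (hx : x ∈ Icc (0 : ℝ) 1) : Summable fun k => a k * x ^ k :=
  summable_mul_of_le_of_nonneg ha hsum (C := 1) (fun _ => pow_nonneg hx.1 _)
    fun _ => pow_le_one₀ hx.1 hx.2

lemma continuousOn_tsum_mul_pow : ContinuousOn (fun x : ℝ => ∑' k, a k * x ^ k) (Icc 0 1) := by
  refine continuousOn_tsum (u := a) (fun k => by fun_prop) hsum fun k x hx => ?_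
  rw [Real.norm_of_nonneg (mul_nonneg (ha k) (pow_nonneg hx.1 _))]
  exact mul_le_of_le_one_right (ha k) (pow_le_one₀ hx.1 hx.2)

/-- Intermediate values: the series minus the identity is positive at `0` and negative at `1`. -/
lemma exists_fixedPoint_tsum_mul_pow (h0 : 0 < a 0) (h1 : ∑' k, a k < 1) :
    ∃ x ∈ Ioo (0 : ℝ) 1, ∑' k, a k * x ^ k = x := by
  have hc : ContinuousOn (fun x : ℝ => ∑' k, a k * x ^ k - x) (Icc 0 1) :=
    (continuousOn_tsum_mul_pow ha hsum).sub continuousOn_id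
  have hv0 : ∑' k, a k * (0 : ℝ) ^ k = a 0 := by
    rw [tsum_eq_single 0 fun k hk => by simp [hk]]
    simp
  obtain ⟨x, hx, hx'⟩ := intermediate_value_Icc' zero_le_one hc
    (show (0 : ℝ) ∈ _ by simp only [hv0, one_pow, mul_one, mem_Icc]; constructor <;> linarith)
  have hx' : ∑' k, a k * x ^ k = x := by linarith [hx']
  refine ⟨x, ⟨lt_of_le_of_ne hx.1 ?_, lt_of_le_of_ne hx.2 ?_⟩, hx'⟩
  · rintro rfl
    rw [hv0] at hx'
    linarith
  · rintro rfl
    simp only [one_pow, mul_one] at hx'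
    linarith

/-- The power series contracts towards a fixed point. -/
lemma abs_tsum_mul_pow_sub_le {κ x : ℝ} (hκ : κ ∈ Ioo (0 : ℝ) 1) (hfix : ∑' k, a k * κ ^ k = κ)
    (hx : x ∈ Icc (0 : ℝ) 1) :
    |∑' k, a k * x ^ k - κ| ≤ (∑' k, a k - κ) / (1 - κ) * |x - κ| := by
  have h1 := summable_mul_pow ha hsum hx
  have h2 : HasSum (fun k => a k * κ ^ k) κ := by
    simpa only [hfix] using (summable_mul_pow ha hsum ⟨hκ.1.le, hκ.2.le⟩).hasSum
  have h3 : HasSum (fun k => a k * ((1 - κ ^ k) / (1 - κ) * |x - κ|))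
      ((∑' k, a k - κ) / (1 - κ) * |x - κ|) := by
    have := ((hsum.hasSum.sub h2).div_const (1 - κ)).mul_right |x - κ|
    refine this.congr_fun fun k => ?_
    ring
  have h4 : HasSum (fun k => a k * x ^ k - a k * κ ^ k) (∑' k, a k * x ^ k - κ) :=
    h1.hasSum.sub h2
  have hle : ∀ k, |a k * x ^ k - a k * κ ^ k| ≤ a k * ((1 - κ ^ k) / (1 - κ) * |x - κ|) := by
    intro k
    rw [← mul_sub, abs_mul, abs_of_nonneg (ha k)]
    exact mul_le_mul_of_nonneg_left (abs_pow_sub_pow_le_div hx hκ.1.le hκ.2 k) (ha k)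
  have h5 := tsum_of_norm_bounded (f := fun k => a k * x ^ k - a k * κ ^ k) h3 hle
  rwa [h4.tsum_eq] at h5

lemma summable_mul_natCast_mul_pow_pred {x : ℝ} (hx0 : 0 ≤ x) (hx1 : x < 1) :
    Summable fun k : ℕ => a k * (k * x ^ (k - 1)) :=
  summable_mul_of_le_of_nonneg ha hsum (fun k => by positivity)
    (natCast_mul_pow_pred_le hx0 hx1)

/-- Summing the tangent-chord inequality; the right side is below `1` as soon as `∑ a k < 1`. -/
lemma tsum_mul_natCast_mul_pow_pred_le {κ : ℝ} (hκ : κ ∈ Ioo (0 : ℝ) 1)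
    (hfix : ∑' k, a k * κ ^ k = κ) :
    ∑' k : ℕ, a k * (k * κ ^ (k - 1)) ≤ (∑' k, a k - κ) / (1 - κ) := by
  have h2 : HasSum (fun k => a k * κ ^ k) κ := by
    simpa only [hfix] using (summable_mul_pow ha hsum ⟨hκ.1.le, hκ.2.le⟩).hasSum
  have h3 : HasSum (fun k => a k * ((1 - κ ^ k) / (1 - κ))) ((∑' k, a k - κ) / (1 - κ)) := by
    refine ((hsum.hasSum.sub h2).div_const (1 - κ)).congr_fun fun k => ?_
    ring
  rw [← h3.tsum_eq]
  exact (summable_mul_natCast_mul_pow_pred ha hsum hκ.1.le hκ.2).tsum_le_tsum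
    (fun k => mul_le_mul_of_nonneg_left (natCast_mul_pow_pred_le_div hκ.1.le hκ.2 k) (ha k))
    h3.summable

lemma hasDerivAt_tsum_mul_pow {κ : ℝ} (hκ : κ ∈ Ioo (0 : ℝ) 1) :
    HasDerivAt (fun x : ℝ => ∑' k, a k * x ^ k) (∑' k : ℕ, a k * (k * κ ^ (k - 1))) κ := by
  obtain ⟨s, hs, hs1⟩ := exists_between hκ.2
  have hs0 : 0 < s := hκ.1.trans hs
  refine hasDerivAt_tsum_of_isPreconnected (t := Ioo 0 s) (y₀ := κ)
    (summable_mul_natCast_mul_pow_pred ha hsum hs0.le hs1) isOpen_Ioo isPreconnected_Ioo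
    (fun k y _ => (hasDerivAt_pow k y).const_mul (a k)) (fun k y hy => ?_) ⟨hκ.1, hs⟩
    (summable_mul_pow ha hsum ⟨hκ.1.le, hκ.2.le⟩) ⟨hκ.1, hs⟩
  have hy0 := hy.1.le
  have hak := ha k
  rw [Real.norm_of_nonneg (by positivity)]
  have := hy.2.le
  gcongr

lemma tendsto_tsum_mul_natCast_mul_pow_pred {g : ℕ → ℝ} {κ : ℝ} (hg0 : ∀ p, 0 ≤ g p)
    (hκ : κ < 1) (hg : Tendsto g atTop (𝓝 κ)) :
    Tendsto (fun p => ∑' k : ℕ, a k * (k * g p ^ (k - 1))) atTop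
      (𝓝 (∑' k : ℕ, a k * (k * κ ^ (k - 1)))) := by
  obtain ⟨s, hs, hs1⟩ := exists_between hκ
  have hs0 : 0 ≤ s := (ge_of_tendsto' hg hg0).trans hs.le
  refine tendsto_tsum_of_dominated_convergence
    (summable_mul_natCast_mul_pow_pred ha hsum hs0 hs1)
    (fun k => ((hg.pow _).const_mul _).const_mul _) ?_
  filter_upwards [hg.eventually_le_const hs] with p hp k
  have h1 := hg0 p
  have h2 := ha k
  rw [Real.norm_of_nonneg (by positivity)]
  gcongr

end PowerSeriesOnUnitInterval

/-! ### Geometric bounds from scalar recursions. -/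

/-- A sequence with `y (p + 1) ≤ b y p + A β ^ (2 p)`, where `b < β < 1`, decays at rate `β`. -/
lemma eventually_le_mul_pow_of_succ_le {y : ℕ → ℝ} {b β A : ℝ} (hb : 0 ≤ b) (hbβ : b < β)
    (hβ : β < 1) (hA : 0 ≤ A) (h : ∀ᶠ p in atTop, y (p + 1) ≤ b * y p + A * β ^ (2 * p)) :
    ∃ K, 0 ≤ K ∧ ∀ᶠ p in atTop, y p ≤ K * β ^ p := by
  obtain ⟨N, hN⟩ := eventually_atTop.1 h
  have hβ0 : 0 < β := hb.trans_lt hbβ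
  -- The first entry starts the induction at `N`; the second gives `A ≤ K (β - b)`, so that `b K + A
  -- ≤ K β` propagates it.
  refine ⟨max (y N / β ^ N) (A / (β - b)), (div_nonneg hA (by linarith)).trans (le_max_right _ _),
    eventually_atTop.2 ⟨N, fun p hp => ?_⟩⟩
  set K := max (y N / β ^ N) (A / (β - b)) with hK
  have hKA : A ≤ K * (β - b) := (div_le_iff₀ (by linarith)).1 (le_max_right _ _)
  induction p, hp using Nat.le_induction with
  | base => exact (div_le_iff₀ (by positivity)).1 (le_max_left _ _)
  | succ p hp ih =>
    have h1 : β ^ (2 * p) ≤ β ^ p := pow_le_pow_of_le_one hβ0.le hβ.le (by omega)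
    calc y (p + 1) ≤ b * y p + A * β ^ (2 * p) := hN p hp
      _ ≤ b * (K * β ^ p) + K * (β - b) * β ^ p := by gcongr
      _ = K * β ^ (p + 1) := by ring

lemma eventually_mul_pow_le_of_le_succ {y : ℕ → ℝ} {α : ℝ} (hα : 0 < α)
    (hy : ∀ᶠ p in atTop, 0 < y p) (h : ∀ᶠ p in atTop, α * y p ≤ y (p + 1)) :
    ∃ K, 0 < K ∧ ∀ᶠ p in atTop, K * α ^ p ≤ y p := by
  obtain ⟨N, hN⟩ := eventually_atTop.1 (hy.and h)
  refine ⟨y N / α ^ N, div_pos (hN N le_rfl).1 (by positivity),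
    eventually_atTop.2 ⟨N, fun p hp => ?_⟩⟩
  induction p, hp using Nat.le_induction with
  | base => exact (div_mul_cancel₀ _ (by positivity)).le
  | succ p hp ih =>
    calc y N / α ^ N * α ^ (p + 1) = α * (y N / α ^ N * α ^ p) := by ring
      _ ≤ α * y p := by gcongr
      _ ≤ y (p + 1) := (hN p hp).2

/-! ### Coefficients of powers of the iterates, and their asymptotics. -/

/-- `u k j`, `j ≤ L`, are the coefficients of order at most `L` of the `k`-th power of a power
series with nonnegative coefficients. -/
structure IsConvPow (L : ℕ) (u : ℕ → ℕ → ℝ) : Prop where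
  nonneg : ∀ k j, 0 ≤ u k j
  zero : ∀ j, u 0 j = if j = 0 then 1 else 0
  succ : ∀ k j, j ≤ L →
    u (k + 1) j = ∑ x ∈ Finset.HasAntidiagonal.antidiagonal j, u 1 x.1 * u k x.2

namespace IsConvPow

variable {L : ℕ} {u : ℕ → ℕ → ℝ}

lemma coeff_zero (hu : IsConvPow L u) (k : ℕ) : u k 0 = u 1 0 ^ k := by
  induction k with
  | zero => simp [hu.zero]
  | succ k ih => rw [hu.succ k 0 (Nat.zero_le _)]; simp [ih, pow_succ']

/-- The two extreme terms of the convolution are split off. In the remaining ones both orders lie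
between `1` and `j`. -/
lemma succ_succ (hu : IsConvPow L u) (k : ℕ) {j : ℕ} (hj : j + 1 ≤ L) :
    u (k + 1) (j + 1) = u 1 0 * u k (j + 1) + u 1 (j + 1) * u 1 0 ^ k +
      ∑ x ∈ (Finset.HasAntidiagonal.antidiagonal j).erase (j, 0), u 1 (x.1 + 1) * u k x.2 := by
  rw [hu.succ k _ hj, Finset.Nat.sum_antidiagonal_succ, add_assoc, ← hu.coeff_zero,
    Finset.add_sum_erase (Finset.HasAntidiagonal.antidiagonal j)
      (fun x : ℕ × ℕ => u 1 (x.1 + 1) * u k x.2) (a := (j, 0)) (by simp)]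

/-- Keep only the contributions where a single one of the `k` factors supplies the whole order `j +
1`. -/
lemma le_apply (hu : IsConvPow L u) (k : ℕ) {j : ℕ} (hj : j + 1 ≤ L) :
    k * u 1 0 ^ (k - 1) * u 1 (j + 1) ≤ u k (j + 1) := by
  induction k with
  | zero => simp [hu.zero]
  | succ k ih =>
    rw [hu.succ_succ k hj]
    have h1 : 0 ≤ ∑ x ∈ (Finset.HasAntidiagonal.antidiagonal j).erase (j, 0),
        u 1 (x.1 + 1) * u k x.2 :=
      Finset.sum_nonneg fun x _ => mul_nonneg (hu.nonneg _ _) (hu.nonneg _ _)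
    have h2 := mul_le_mul_of_nonneg_left ih (hu.nonneg 1 0)
    have h3 : (k : ℝ) * (u 1 0 * u 1 0 ^ (k - 1)) = k * u 1 0 ^ k := by
      rcases k with _ | k
      · simp
      · rw [Nat.add_sub_cancel, ← pow_succ']
    have h4 : u 1 0 * (k * u 1 0 ^ (k - 1) * u 1 (j + 1)) = k * u 1 0 ^ k * u 1 (j + 1) := by
      rw [← h3]; ring
    rw [Nat.add_sub_cancel]
    push_cast
    linarith

/-- Each added factor creates at most `j + 1` mixed terms of size `B ^ 2`, and multiplies the
earlier error by `u 1 0 ≤ s`. The geometric sum of errors is what makes the bound uniform in `k`. -/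
lemma apply_le (hu : IsConvPow L u) (k : ℕ) {j : ℕ} (hj : j + 1 ≤ L) {s B : ℝ} (hs : u 1 0 ≤ s)
    (hs1 : s < 1) (hB : ∀ i, 1 ≤ i → i ≤ j → ∀ k, u k i ≤ B) :
    u k (j + 1) ≤ k * u 1 0 ^ (k - 1) * u 1 (j + 1) + (j + 1) / (1 - s) * B ^ 2 := by
  have hs' : 0 < 1 - s := by linarith
  induction k with
  | zero =>
    simp only [hu.zero, Nat.add_eq_zero_iff, one_ne_zero, and_false, if_false, Nat.cast_zero,
      zero_mul, zero_add]
    positivity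
  | succ k ih =>
    rw [hu.succ_succ k hj]
    have h1 : ∑ x ∈ (Finset.HasAntidiagonal.antidiagonal j).erase (j, 0),
        u 1 (x.1 + 1) * u k x.2 ≤ (j + 1) * B ^ 2 := by
      have : ∀ x ∈ (Finset.HasAntidiagonal.antidiagonal j).erase (j, 0),
          u 1 (x.1 + 1) * u k x.2 ≤ B ^ 2 := by
        rintro ⟨x, y⟩ hx
        simp only [Finset.mem_erase, ne_eq, Prod.mk.injEq, Finset.HasAntidiagonal.mem_antidiagonal] at hx
        have h := hB (x + 1) (by omega) (by omega) 1
        rw [sq]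
        exact mul_le_mul h (hB y (by omega) (by omega) k) (hu.nonneg _ _)
          ((hu.nonneg _ _).trans h)
      refine (Finset.sum_le_card_nsmul _ _ _ this).trans ?_
      rw [nsmul_eq_mul]
      gcongr
      calc (((Finset.HasAntidiagonal.antidiagonal j).erase (j, 0)).card : ℝ)
          ≤ (Finset.HasAntidiagonal.antidiagonal j).card := by
            exact_mod_cast Finset.card_erase_le
        _ = j + 1 := by simp
    have h2 := mul_le_mul_of_nonneg_left ih (hu.nonneg 1 0)
    have h3 : (k : ℝ) * (u 1 0 * u 1 0 ^ (k - 1)) = k * u 1 0 ^ k := by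
      rcases k with _ | k
      · simp
      · rw [Nat.add_sub_cancel, ← pow_succ']
    have h4 : u 1 0 * (k * u 1 0 ^ (k - 1) * u 1 (j + 1)) = k * u 1 0 ^ k * u 1 (j + 1) := by
      rw [← h3]; ring
    have h5 : u 1 0 * ((j + 1) / (1 - s) * B ^ 2) ≤ s * ((j + 1) / (1 - s) * B ^ 2) := by
      gcongr
    have h6 : (1 - s) * ((j + 1) / (1 - s) * B ^ 2) = (j + 1) * B ^ 2 := by
      field_simp
    rw [Nat.add_sub_cancel]
    push_cast
    linarith

end IsConvPow

/-- `c p k j` are the coefficients of order at most `L` of `G_p ^ k`, where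
`G_{p + 1} = ∑ k, a k G_p ^ k`. -/
structure IsPgfIteration (a : ℕ → ℝ) (L : ℕ) (c : ℕ → ℕ → ℕ → ℝ) : Prop where
  coeff_nonneg : ∀ k, 0 ≤ a k
  summable : Summable a
  isConvPow : ∀ p, IsConvPow L (c p)
  step : ∀ p j, j ≤ L → HasSum (fun k => a k * c p k j) (c (p + 1) 1 j)

namespace IsPgfIteration

variable {a : ℕ → ℝ} {L : ℕ} {c : ℕ → ℕ → ℕ → ℝ} {κ : ℝ}

lemma succ_ge (hc : IsPgfIteration a L c) {p j : ℕ} (hj : j + 1 ≤ L) (hp : c p 1 0 < 1) :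
    (∑' k : ℕ, a k * (k * c p 1 0 ^ (k - 1))) * c p 1 (j + 1) ≤ c (p + 1) 1 (j + 1) := by
  have h1 := summable_mul_natCast_mul_pow_pred hc.coeff_nonneg hc.summable
    ((hc.isConvPow p).nonneg 1 0) hp
  refine hasSum_le (fun k => ?_) (h1.hasSum.mul_right _) (hc.step p (j + 1) hj)
  rw [mul_assoc]
  exact mul_le_mul_of_nonneg_left ((hc.isConvPow p).le_apply k hj) (hc.coeff_nonneg k)

lemma succ_le (hc : IsPgfIteration a L c) {p j : ℕ} (hj : j + 1 ≤ L) {s B : ℝ}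
    (hp : c p 1 0 ≤ s) (hs : s < 1) (hB : ∀ i, 1 ≤ i → i ≤ j → ∀ k, c p k i ≤ B) :
    c (p + 1) 1 (j + 1) ≤ (∑' k : ℕ, a k * (k * c p 1 0 ^ (k - 1))) * c p 1 (j + 1) +
      (∑' k, a k) * ((j + 1) / (1 - s) * B ^ 2) := by
  have h1 := summable_mul_natCast_mul_pow_pred hc.coeff_nonneg hc.summable
    ((hc.isConvPow p).nonneg 1 0) (hp.trans_lt hs)
  refine hasSum_le (fun k => ?_) (hc.step p (j + 1) hj)
    ((h1.hasSum.mul_right _).add (hc.summable.hasSum.mul_right _))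
  rw [mul_assoc, ← mul_add]
  exact mul_le_mul_of_nonneg_left ((hc.isConvPow p).apply_le k hj hp hs hB) (hc.coeff_nonneg k)

/-- The coefficients of positive order decay at every rate `β` larger than the derivative at the
attracting fixed point. -/
lemma eventually_le_mul_pow (hc : IsPgfIteration a L c) (hκ1 : κ < 1)
    (hκ : Tendsto (fun p => c p 1 0) atTop (𝓝 κ)) {β : ℝ}
    (hβ : ∑' k : ℕ, a k * (k * κ ^ (k - 1)) < β) (hβ1 : β < 1) (j : ℕ) :
    ∃ K, 0 ≤ K ∧ ∀ᶠ p in atTop, ∀ i, 1 ≤ i → i ≤ j → i ≤ L → ∀ k, c p k i ≤ K * β ^ p := by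
  have hg0 : ∀ p, 0 ≤ c p 1 0 := fun p => (hc.isConvPow p).nonneg 1 0
  have hκ0 : 0 ≤ κ := ge_of_tendsto' hκ hg0
  have hD0 : 0 ≤ ∑' k : ℕ, a k * (k * κ ^ (k - 1)) := tsum_nonneg fun k =>
    mul_nonneg (hc.coeff_nonneg k) (by positivity)
  have hβ0 : 0 < β := hD0.trans_lt hβ
  induction j with
  | zero => exact ⟨0, le_rfl, Eventually.of_forall fun p i h1 h2 => by omega⟩
  | succ j ih =>
    obtain ⟨K, hK0, hK⟩ := ih
    by_cases hj : j + 1 ≤ L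
    swap
    · refine ⟨K, hK0, hK.mono fun p hp i h1 h2 h3 => hp i h1 (by omega) h3⟩
    -- The order `j + 1` obeys a linear recursion whose multiplier is eventually at most `b < β`.
    -- Its forcing term is quadratic in the lower orders, hence `O(β ^ (2 p))` by induction.
    obtain ⟨b, hb, hbβ⟩ := exists_between hβ
    obtain ⟨s, hs, hs1⟩ := exists_between hκ1
    have hs0 : 0 ≤ s := hκ0.trans hs.le
    have hs' : 0 < 1 - s := by linarith
    have ha0 : 0 ≤ ∑' k, a k := tsum_nonneg hc.coeff_nonneg
    have hlt := hκ.eventually_le_const hs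
    have hDb := (tendsto_tsum_mul_natCast_mul_pow_pred hc.coeff_nonneg hc.summable hg0 hκ1
      hκ).eventually_le_const hb
    obtain ⟨K', hK'0, hK'⟩ := eventually_le_mul_pow_of_succ_le (y := fun p => c p 1 (j + 1))
      (A := (∑' k, a k) * ((j + 1) / (1 - s) * K ^ 2)) (hD0.trans hb.le) hbβ hβ1
      (by positivity) (by
        filter_upwards [hK, hlt, hDb] with p hp1 hp2 hp3
        refine (hc.succ_le hj hp2 hs1 fun i h1 h2 k => hp1 i h1 h2 (by omega) k).trans ?_
        have := (hc.isConvPow p).nonneg 1 (j + 1)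
        have h2 : (K * β ^ p) ^ 2 = K ^ 2 * β ^ (2 * p) := by ring
        rw [h2]
        have := mul_le_mul_of_nonneg_right hp3 this
        nlinarith)
    -- `K` serves the orders up to `j`. For order `j + 1`, `apply_le` passes from the first power to
    -- all powers, with `k * c p 1 0 ^ (k - 1) ≤ 1 / (1 - s)`.
    refine ⟨max K (1 / (1 - s) * K' + (j + 1) / (1 - s) * K ^ 2), hK0.trans (le_max_left _ _), ?_⟩
    filter_upwards [hK, hlt, hK'] with p hp1 hp2 hp3 i h1 h2 h3 k
    rcases Nat.lt_or_eq_of_le h2 with h2 | rfl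
    · refine (hp1 i h1 (by omega) h3 k).trans ?_
      gcongr
      exact le_max_left _ _
    · refine ((hc.isConvPow p).apply_le k hj hp2 hs1
        fun i h1 h2 k => hp1 i h1 h2 (by omega) k).trans ?_
      have hk : k * c p 1 0 ^ (k - 1) ≤ 1 / (1 - s) := by
        refine le_trans ?_ (natCast_mul_pow_pred_le hs0 hs1 k)
        have := hg0 p
        gcongr
      have hβp : β ^ (2 * p) ≤ β ^ p := pow_le_pow_of_le_one hβ0.le hβ1.le (by omega)
      have hnn := (hc.isConvPow p).nonneg 1 (j + 1)
      calc k * c p 1 0 ^ (k - 1) * c p 1 (j + 1) + (j + 1) / (1 - s) * (K * β ^ p) ^ 2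
          = k * c p 1 0 ^ (k - 1) * c p 1 (j + 1) + (j + 1) / (1 - s) * K ^ 2 * β ^ (2 * p) := by
            ring
        _ ≤ 1 / (1 - s) * (K' * β ^ p) + (j + 1) / (1 - s) * K ^ 2 * β ^ p := by
            gcongr
        _ = (1 / (1 - s) * K' + (j + 1) / (1 - s) * K ^ 2) * β ^ p := by ring
        _ ≤ _ := by
            gcongr
            exact le_max_right _ _

/-- Asymptotically, the top coefficient of the `k`-th power comes from a single factor. -/
lemma tendsto_div_of_pos (hc : IsPgfIteration a L c) (hL : 1 ≤ L) (hκ1 : κ < 1)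
    (hκ : Tendsto (fun p => c p 1 0) atTop (𝓝 κ))
    (hD0 : 0 < ∑' k : ℕ, a k * (k * κ ^ (k - 1)))
    (hD1 : ∑' k : ℕ, a k * (k * κ ^ (k - 1)) < 1) (hpos : ∀ᶠ p in atTop, 0 < c p 1 L) :
    (∃ K, ∀ᶠ p in atTop, ∀ k, c p k L / c p 1 L ≤ K) ∧
      ∀ k : ℕ, Tendsto (fun p => c p k L / c p 1 L) atTop (𝓝 (k * κ ^ (k - 1))) := by
  obtain ⟨j, rfl⟩ : ∃ j, L = j + 1 := ⟨L - 1, by omega⟩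
  set D := ∑' k : ℕ, a k * (k * κ ^ (k - 1)) with hD
  have hg0 : ∀ p, 0 ≤ c p 1 0 := fun p => (hc.isConvPow p).nonneg 1 0
  have hκ0 : 0 ≤ κ := ge_of_tendsto' hκ hg0
  -- As `0 < D < 1`, there is room for `D < β < √D` and then `β ^ 2 < α < D`: the squared decay of
  -- the lower orders beats the lower bound on the top one.
  have hsq : D < √D := Real.lt_sqrt_of_sq_lt (by nlinarith)
  obtain ⟨β, hβ, hβs⟩ := exists_between hsq
  have hβ0 : 0 < β := hD0.trans hβ
  have hβ2 : β ^ 2 < D := (Real.lt_sqrt hβ0.le).1 hβs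
  have hβ1 : β < 1 := by nlinarith
  obtain ⟨α, hα, hαD⟩ := exists_between hβ2
  have hα0 : 0 < α := (by positivity : 0 < β ^ 2).trans hα
  obtain ⟨s, hs, hs1⟩ := exists_between hκ1
  have hs0 : 0 ≤ s := hκ0.trans hs.le
  have hs' : 0 < 1 - s := by linarith
  have hlt := hκ.eventually_le_const hs
  have hDα := (tendsto_tsum_mul_natCast_mul_pow_pred hc.coeff_nonneg hc.summable hg0 hκ1
    hκ).eventually_const_le hαD
  obtain ⟨K, hK0, hK⟩ := hc.eventually_le_mul_pow hκ1 hκ hβ hβ1 j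
  obtain ⟨C, hC0, hC⟩ := eventually_mul_pow_le_of_le_succ hα0 hpos (by
    filter_upwards [hDα, hlt] with p hp1 hp2
    refine le_trans ?_ (hc.succ_ge le_rfl (hp2.trans_lt hs1))
    exact mul_le_mul_of_nonneg_right hp1 ((hc.isConvPow p).nonneg _ _))
  set R := (j + 1) / (1 - s) * K ^ 2 / C with hR
  have hR0 : 0 ≤ R := by positivity
  have hbound : ∀ᶠ p in atTop, ∀ k : ℕ, c p k (j + 1) / c p 1 (j + 1) ≤
      k * c p 1 0 ^ (k - 1) + R * (β ^ 2 / α) ^ p := by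
    filter_upwards [hlt, hK, hC, hpos] with p hp1 hp2 hp3 hp4 k
    rw [div_le_iff₀ hp4, add_mul]
    refine ((hc.isConvPow p).apply_le k le_rfl hp1 hs1
      fun i h1 h2 k => hp2 i h1 h2 (by omega) k).trans (add_le_add_right ?_ _)
    calc (j + 1) / (1 - s) * (K * β ^ p) ^ 2 = R * (β ^ 2 / α) ^ p * (C * α ^ p) := by
          rw [hR, div_pow]
          field_simp
          ring
      _ ≤ _ := by gcongr
  have hq0 : 0 ≤ β ^ 2 / α := by positivity
  have hq1 : β ^ 2 / α < 1 := (div_lt_one hα0).2 hα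
  constructor
  · refine ⟨1 / (1 - s) + R, ?_⟩
    filter_upwards [hbound, hlt] with p hp1 hp2 k
    refine (hp1 k).trans (add_le_add ?_ (mul_le_of_le_one_right hR0 (pow_le_one₀ hq0 hq1.le)))
    refine le_trans ?_ (natCast_mul_pow_pred_le hs0 hs1 k)
    have := hg0 p
    gcongr
  · intro k
    have hlow : Tendsto (fun p => k * c p 1 0 ^ (k - 1)) atTop (𝓝 (k * κ ^ (k - 1))) :=
      (hκ.pow _).const_mul _
    have hup : Tendsto (fun p => k * c p 1 0 ^ (k - 1) + R * (β ^ 2 / α) ^ p) atTop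
        (𝓝 (k * κ ^ (k - 1))) := by
      simpa using hlow.add ((tendsto_pow_atTop_nhds_zero_of_lt_one hq0 hq1).const_mul R)
    refine tendsto_of_tendsto_of_tendsto_of_le_of_le' hlow hup ?_
      (hbound.mono fun p hp => hp k)
    filter_upwards [hpos] with p hp
    rw [le_div_iff₀ hp]
    exact (hc.isConvPow p).le_apply k le_rfl

end IsPgfIteration

/-! ### Positivity, convergence of the constant terms, and growth ratios. -/

namespace IsConvPow

variable {L : ℕ} {u : ℕ → ℕ → ℝ}

lemma mul_le_succ (hu : IsConvPow L u) (k i j : ℕ) (hij : i + j ≤ L) :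
    u 1 i * u k j ≤ u (k + 1) (i + j) := by
  rw [hu.succ k _ hij]
  exact Finset.single_le_sum (f := fun x : ℕ × ℕ => u 1 x.1 * u k x.2)
    (fun x _ => mul_nonneg (hu.nonneg _ _) (hu.nonneg _ _)) (a := (i, j)) (by simp)

lemma apply_one_pos (hu : IsConvPow L u) (hL : 1 ≤ L) (h0 : 0 < u 1 0) (h1 : 0 < u 1 1) {k : ℕ}
    (hk : 1 ≤ k) : 0 < u k 1 := by
  refine lt_of_lt_of_le ?_ (hu.le_apply k (j := 0) hL)
  have : (0 : ℝ) < k := by exact_mod_cast hk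
  positivity

end IsConvPow

namespace IsPgfIteration

variable {a : ℕ → ℝ} {L : ℕ} {c : ℕ → ℕ → ℕ → ℝ} {κ : ℝ}

lemma mul_le_succ (hc : IsPgfIteration a L c) (p k : ℕ) {j : ℕ} (hj : j ≤ L) :
    a k * c p k j ≤ c (p + 1) 1 j :=
  le_hasSum (hc.step p j hj) k fun i _ =>
    mul_nonneg (hc.coeff_nonneg i) ((hc.isConvPow p).nonneg i j)

lemma succ_one_zero (hc : IsPgfIteration a L c) (p : ℕ) :
    c (p + 1) 1 0 = ∑' k, a k * c p 1 0 ^ k := by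
  rw [← (hc.step p 0 (Nat.zero_le _)).tsum_eq]
  exact tsum_congr fun k => by rw [(hc.isConvPow p).coeff_zero]

lemma one_zero_pos (hc : IsPgfIteration a L c) (ha : 0 < a 0) (h0 : 0 < c 0 1 0) (p : ℕ) :
    0 < c p 1 0 := by
  rcases p with _ | p
  · exact h0
  · refine lt_of_lt_of_le ?_ (hc.mul_le_succ p 0 (Nat.zero_le _))
    simpa [(hc.isConvPow p).zero] using ha

lemma one_one_pos (hc : IsPgfIteration a L c) (hL : 1 ≤ L) (ha : 0 < a 0) (h0 : 0 < c 0 1 0)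
    (h1 : 0 < c 0 1 1) (hk : ∃ k, 1 ≤ k ∧ 0 < a k) (p : ℕ) : 0 < c p 1 1 := by
  obtain ⟨k, hk, hak⟩ := hk
  induction p with
  | zero => exact h1
  | succ p ih =>
    exact lt_of_lt_of_le (mul_pos hak ((hc.isConvPow p).apply_one_pos hL
      (hc.one_zero_pos ha h0 p) ih hk)) (hc.mul_le_succ p k hL)

/-- Positivity spreads by one order per iteration: in a power `k ≥ 2`, one factor supplies order `j`
and the others supply order `1`. -/
lemma one_pos_of_le (hc : IsPgfIteration a L c) (ha : 0 < a 0) (h0 : 0 < c 0 1 0)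
    (h1 : 0 < c 0 1 1) (hk : ∃ k, 2 ≤ k ∧ 0 < a k) (p : ℕ) :
    ∀ j, j ≤ p + 1 → j ≤ L → 0 < c p 1 j := by
  have hone : 1 ≤ L → ∀ p, 0 < c p 1 1 := fun hL p =>
    hc.one_one_pos hL ha h0 h1 (hk.imp fun k hk => ⟨by omega, hk.2⟩) p
  obtain ⟨k, hk, hak⟩ := hk
  induction p with
  | zero =>
    intro j hj _
    interval_cases j
    · exact h0
    · exact h1
  | succ p ih =>
    intro j hj hjL
    rcases j with _ | j
    · exact hc.one_zero_pos ha h0 _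
    · obtain ⟨m, rfl⟩ : ∃ m, k = m + 1 := ⟨k - 1, by omega⟩
      refine lt_of_lt_of_le (mul_pos hak ?_) (hc.mul_le_succ p (m + 1) hjL)
      exact lt_of_lt_of_le (mul_pos (ih j (by omega) (by omega))
        ((hc.isConvPow p).apply_one_pos (by omega) (hc.one_zero_pos ha h0 p)
          (hone (by omega) p) (by omega))) ((hc.isConvPow p).mul_le_succ m j 1 hjL)

lemma eventually_one_pos (hc : IsPgfIteration a L c) (ha : 0 < a 0) (h0 : 0 < c 0 1 0)
    (h1 : 0 < c 0 1 1) (hk : ∃ k, min L 2 ≤ k ∧ 0 < a k) : ∀ᶠ p in atTop, 0 < c p 1 L := by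
  rcases Nat.lt_or_ge L 2 with hL | hL
  · refine Eventually.of_forall fun p => ?_
    interval_cases L
    · exact hc.one_zero_pos ha h0 p
    · exact hc.one_one_pos le_rfl ha h0 h1 (by simpa using hk) p
  · rw [min_eq_right hL] at hk
    filter_upwards [eventually_ge_atTop L] with p hp
    exact hc.one_pos_of_le ha h0 h1 hk p L (by omega) le_rfl

/-- The constant terms are the iterates of the generating function on `[0, 1]`, which contracts
towards `κ` by the chord slope `ρ < 1`. -/
lemma tendsto_one_zero (hc : IsPgfIteration a L c) (hκ : κ ∈ Ioo (0 : ℝ) 1)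
    (hfix : ∑' k, a k * κ ^ k = κ) (h1 : ∑' k, a k < 1) (h0 : c 0 1 0 ≤ 1) :
    Tendsto (fun p => c p 1 0) atTop (𝓝 κ) := by
  have hmem : ∀ p, c p 1 0 ∈ Icc (0 : ℝ) 1 := by
    intro p
    refine ⟨(hc.isConvPow p).nonneg 1 0, ?_⟩
    induction p with
    | zero => exact h0
    | succ p ih =>
      have hp : c p 1 0 ∈ Icc (0 : ℝ) 1 := ⟨(hc.isConvPow p).nonneg 1 0, ih⟩
      rw [hc.succ_one_zero]
      refine le_trans ?_ h1.le
      exact (summable_mul_pow hc.coeff_nonneg hc.summable hp).tsum_le_tsum (fun k =>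
        mul_le_of_le_one_right (hc.coeff_nonneg k) (pow_le_one₀ hp.1 hp.2)) hc.summable
  set ρ := (∑' k, a k - κ) / (1 - κ) with hρ
  have hκ1 : 0 < 1 - κ := by linarith [hκ.2]
  have hρ1 : ρ < 1 := by rw [hρ, div_lt_one hκ1]; linarith
  have hρ0 : 0 ≤ ρ := le_trans (tsum_nonneg fun k => mul_nonneg (hc.coeff_nonneg k)
      (by have := hκ.1.le; positivity))
    (tsum_mul_natCast_mul_pow_pred_le hc.coeff_nonneg hc.summable hκ hfix)
  have hle : ∀ p, |c p 1 0 - κ| ≤ ρ ^ p * |c 0 1 0 - κ| := by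
    intro p
    induction p with
    | zero => simp
    | succ p ih =>
      rw [hc.succ_one_zero, pow_succ', mul_assoc]
      exact (abs_tsum_mul_pow_sub_le hc.coeff_nonneg hc.summable hκ hfix (hmem p)).trans
        (mul_le_mul_of_nonneg_left ih hρ0)
  rw [tendsto_iff_dist_tendsto_zero]
  refine squeeze_zero (fun _ => dist_nonneg) (fun p => (Real.dist_eq _ _).trans_le (hle p)) ?_
  simpa only [zero_mul] using (tendsto_pow_atTop_nhds_zero_of_lt_one hρ0 hρ1).mul_const |c 0 1 0 - κ|

lemma tendsto_div_of_pos_of_eq_zero (hc : IsPgfIteration a 0 c) (hκ0 : 0 < κ) (hκ1 : κ < 1)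
    (hκ : Tendsto (fun p => c p 1 0) atTop (𝓝 κ)) :
    (∃ K, ∀ᶠ p in atTop, ∀ k, c p k 0 / c p 1 0 ≤ K) ∧
      ∀ k : ℕ, Tendsto (fun p => c p k 0 / c p 1 0) atTop (𝓝 (κ ^ ((k : ℤ) - 1))) := by
  constructor
  · refine ⟨2 / κ, ?_⟩
    filter_upwards [hκ.eventually_const_le (half_lt_self hκ0), hκ.eventually_le_const hκ1]
      with p hp1 hp2 k
    rw [(hc.isConvPow p).coeff_zero]
    have h1 : c p 1 0 ^ k ≤ 1 := pow_le_one₀ (by linarith) hp2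
    calc c p 1 0 ^ k / c p 1 0 ≤ 1 / (κ / 2) := by gcongr
      _ = 2 / κ := by rw [one_div_div]
  · intro k
    have h : ∀ p, c p k 0 / c p 1 0 = c p 1 0 ^ k / c p 1 0 := fun p => by
      rw [(hc.isConvPow p).coeff_zero]
    simp only [h]
    rw [zpow_sub₀ hκ0.ne', zpow_natCast, zpow_one]
    exact (hκ.pow k).div hκ hκ0.ne'

/-- If the ratios `c p k L / c p 1 L` converge boundedly to `φ k`, the coefficients `c p 1 L` are
asymptotically geometric with ratio `∑ k, a k φ k`. -/
lemma tendsto_add_div (hc : IsPgfIteration a L c) {φ : ℕ → ℝ} {K : ℝ}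
    (hK : ∀ᶠ p in atTop, ∀ k, c p k L / c p 1 L ≤ K)
    (hφ : ∀ k, Tendsto (fun p => c p k L / c p 1 L) atTop (𝓝 (φ k)))
    (hpos : ∀ᶠ p in atTop, 0 < c p 1 L) (n : ℕ) :
    Tendsto (fun p => c (n + p) 1 L / c p 1 L) atTop (𝓝 ((∑' k, a k * φ k) ^ n)) := by
  have hstep : Tendsto (fun p => c (p + 1) 1 L / c p 1 L) atTop (𝓝 (∑' k, a k * φ k)) := by
    have h1 : ∀ p, c (p + 1) 1 L / c p 1 L = ∑' k, a k * (c p k L / c p 1 L) := by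
      intro p
      rw [← ((hc.step p L le_rfl).div_const (c p 1 L)).tsum_eq]
      exact tsum_congr fun k => mul_div_assoc _ _ _
    simp only [h1]
    refine tendsto_tsum_of_dominated_convergence (hc.summable.mul_right K)
      (fun k => (hφ k).const_mul _) ?_
    filter_upwards [hK] with p hp k
    have := (hc.isConvPow p).nonneg
    rw [Real.norm_of_nonneg (mul_nonneg (hc.coeff_nonneg k) (div_nonneg (this _ _) (this _ _)))]
    exact mul_le_mul_of_nonneg_left (hp k) (hc.coeff_nonneg k)
  induction n with
  | zero =>
    refine tendsto_const_nhds.congr' ?_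
    filter_upwards [hpos] with p hp
    rw [zero_add, div_self hp.ne', pow_zero]
  | succ n ih =>
    have hshift : Tendsto (fun p => n + p) atTop atTop :=
      tendsto_atTop_mono (fun p => Nat.le_add_left p n) tendsto_id
    have := (hstep.comp hshift).mul ih
    rw [← pow_succ'] at this
    refine this.congr' ?_
    filter_upwards [hshift.eventually hpos] with p hp
    simp only [Function.comp_apply]
    rw [div_mul_div_cancel₀ hp.ne', add_right_comm]

end IsPgfIteration

/-! ### Finiteness of the coefficients under the moment assumption. -/

section Finiteness

/-- Because the constant term is at most `1`, coefficients up to order `j` of `Y ^ k` grow at most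
like `k ^ j`. Hence a moment of order `L` keeps every iterate finite up to order `L`. -/
lemma PowerSeries.exists_coeff_pow_le {L : ℕ} {Y : PowerSeries ℝ≥0∞}
    (h0 : PowerSeries.coeff 0 Y ≤ 1) (hY : ∀ j ≤ L, PowerSeries.coeff j Y ≠ ∞) (j : ℕ) :
    ∃ K : ℝ≥0∞, K ≠ ∞ ∧ ∀ i ≤ j, i ≤ L → ∀ k : ℕ,
      PowerSeries.coeff i (Y ^ k) ≤ K * ((k : ℝ≥0∞) + 1) ^ j := by
  induction j with
  | zero =>
    refine ⟨1, ENNReal.one_ne_top, fun i hi _ k => ?_⟩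
    obtain rfl := Nat.le_zero.1 hi
    rw [pow_zero, mul_one, PowerSeries.coeff_zero_eq_constantCoeff, map_pow]
    exact pow_le_one₀ zero_le (by rwa [PowerSeries.coeff_zero_eq_constantCoeff] at h0)
  | succ j ih =>
    obtain ⟨K, hK, hKle⟩ := ih
    by_cases hj : j + 1 ≤ L
    swap
    · refine ⟨K, hK, fun i hi hiL k => (hKle i (by omega) hiL k).trans ?_⟩
      gcongr
      · exact le_add_self
      · exact Nat.le_succ j
    set M := ∑ x ∈ Finset.HasAntidiagonal.antidiagonal j, PowerSeries.coeff (x.1 + 1) Y * K with hM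
    have hMtop : M ≠ ∞ := by
      refine ENNReal.sum_ne_top.2 fun x hx => ENNReal.mul_ne_top (hY _ ?_) hK
      have := Finset.HasAntidiagonal.mem_antidiagonal.1 hx
      omega
    -- Each new factor adds at most `M (k + 1) ^ j`, by the bound for lower orders; adding `k` such
    -- terms raises the degree by one.
    have hrec : ∀ k : ℕ, PowerSeries.coeff (j + 1) (Y ^ k) ≤ k * (M * ((k : ℝ≥0∞) + 1) ^ j) := by
      intro k
      induction k with
      | zero => simp [PowerSeries.coeff_one]
      | succ k ihk =>
        rw [pow_succ', PowerSeries.coeff_mul, Finset.Nat.sum_antidiagonal_succ, Nat.cast_succ,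
          add_mul, one_mul]
        refine add_le_add ?_ ?_
        · calc PowerSeries.coeff 0 Y * PowerSeries.coeff (j + 1) (Y ^ k)
              ≤ 1 * (k * (M * ((k : ℝ≥0∞) + 1) ^ j)) := mul_le_mul' h0 ihk
            _ ≤ _ := by
              rw [one_mul]
              gcongr
              exact le_self_add
        · rw [hM, Finset.sum_mul]
          refine Finset.sum_le_sum fun x hx => ?_
          have hx' := Finset.HasAntidiagonal.mem_antidiagonal.1 hx
          rw [mul_assoc]
          gcongr
          refine (hKle x.2 (by omega) (by omega) k).trans ?_
          gcongr
          exact le_self_add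
    refine ⟨K + M, ENNReal.add_ne_top.2 ⟨hK, hMtop⟩, fun i hi hiL k => ?_⟩
    rcases Nat.lt_or_eq_of_le hi with hi | rfl
    · refine (hKle i (by omega) hiL k).trans ?_
      gcongr
      · exact le_self_add
      · exact le_add_self
      · exact Nat.le_succ j
    · refine (hrec k).trans ?_
      calc (k : ℝ≥0∞) * (M * ((k : ℝ≥0∞) + 1) ^ j)
          ≤ ((k : ℝ≥0∞) + 1) * ((K + M) * ((k : ℝ≥0∞) + 1) ^ j) := by
            gcongr
            · exact le_self_add
            · exact le_add_self
        _ = (K + M) * ((k : ℝ≥0∞) + 1) ^ (j + 1) := by ring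

lemma tsum_add_one_pow_mul_ne_top {b : ℕ → ℝ≥0∞} {L : ℕ} (h0 : ∑' k, b k ≠ ∞)
    (hL : ∑' k : ℕ, (k : ℝ≥0∞) ^ L * b k ≠ ∞) : ∑' k : ℕ, b k * ((k : ℝ≥0∞) + 1) ^ L ≠ ∞ := by
  have hle : ∀ k : ℕ, ((k : ℝ≥0∞) + 1) ^ L ≤ 2 ^ (L - 1) * ((k : ℝ≥0∞) ^ L + 1) := by
    intro k
    have := add_pow_le (Nat.zero_le k) zero_le_one L
    rw [one_pow] at this
    exact_mod_cast this
  refine ne_top_of_le_ne_top (b := 2 ^ (L - 1) * (∑' k : ℕ, (k : ℝ≥0∞) ^ L * b k + ∑' k, b k))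
    (ENNReal.mul_ne_top (by simp) (ENNReal.add_ne_top.2 ⟨hL, h0⟩)) ?_
  rw [← ENNReal.tsum_add, ← ENNReal.tsum_mul_left]
  refine ENNReal.tsum_le_tsum fun k => ?_
  calc b k * ((k : ℝ≥0∞) + 1) ^ L ≤ b k * (2 ^ (L - 1) * ((k : ℝ≥0∞) ^ L + 1)) := by
        gcongr
        exact hle k
    _ = 2 ^ (L - 1) * ((k : ℝ≥0∞) ^ L * b k + b k) := by ring

variable {p₀ : PMF (ℕ × Bool)} {L : ℕ} {Y : PowerSeries ℝ≥0∞}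

lemma tsum_pmf_false_le_one (p₀ : PMF (ℕ × Bool)) : ∑' k, p₀ (k, false) ≤ 1 := by
  rw [← p₀.tsum_coe]
  exact ENNReal.tsum_comp_le_tsum_of_injective (Prod.mk_left_injective false) _

lemma coeff_zero_pgfStep_le_one (h0 : PowerSeries.coeff 0 Y ≤ 1) :
    PowerSeries.coeff 0 (pgfStep p₀ Y) ≤ 1 := by
  rw [pgfStep, PowerSeries.coeff_mk]
  refine le_trans (ENNReal.tsum_le_tsum fun k => mul_le_of_le_one_right' ?_)
    (tsum_pmf_false_le_one p₀)
  rw [PowerSeries.coeff_zero_eq_constantCoeff] at h0 ⊢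
  rw [map_pow]
  exact pow_le_one₀ zero_le h0

lemma coeff_pgfStep_ne_top (hmom : ∑' k : ℕ, (k : ℝ≥0∞) ^ L * p₀ (k, false) ≠ ∞)
    (h0 : PowerSeries.coeff 0 Y ≤ 1) (hY : ∀ j ≤ L, PowerSeries.coeff j Y ≠ ∞) :
    ∀ j ≤ L, PowerSeries.coeff j (pgfStep p₀ Y) ≠ ∞ := by
  intro j hj
  obtain ⟨K, hK, hKle⟩ := PowerSeries.exists_coeff_pow_le h0 hY L
  rw [pgfStep, PowerSeries.coeff_mk]
  refine ne_top_of_le_ne_top (b := K * ∑' k : ℕ, p₀ (k, false) * ((k : ℝ≥0∞) + 1) ^ L)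
    (ENNReal.mul_ne_top hK (tsum_add_one_pow_mul_ne_top
      (ne_top_of_le_ne_top ENNReal.one_ne_top (tsum_pmf_false_le_one p₀)) hmom)) ?_
  rw [← ENNReal.tsum_mul_left]
  refine ENNReal.tsum_le_tsum fun k => ?_
  rw [mul_left_comm]
  gcongr
  exact hKle j hj hj k

lemma coeff_iterate_pgfStep_ne_top (hmom : ∑' k : ℕ, (k : ℝ≥0∞) ^ L * p₀ (k, false) ≠ ∞)
    (h0 : PowerSeries.coeff 0 Y ≤ 1) (hY : ∀ j ≤ L, PowerSeries.coeff j Y ≠ ∞) (m : ℕ) :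
    PowerSeries.coeff 0 ((pgfStep p₀)^[m] Y) ≤ 1 ∧
      ∀ j ≤ L, PowerSeries.coeff j ((pgfStep p₀)^[m] Y) ≠ ∞ := by
  induction m with
  | zero => exact ⟨h0, hY⟩
  | succ m ih =>
    rw [Function.iterate_succ_apply']
    exact ⟨coeff_zero_pgfStep_le_one ih.1, coeff_pgfStep_ne_top hmom ih.1 ih.2⟩

lemma PowerSeries.coeff_pow_ne_top (h0 : PowerSeries.coeff 0 Y ≤ 1)
    (hY : ∀ j ≤ L, PowerSeries.coeff j Y ≠ ∞) {j : ℕ} (hj : j ≤ L) (k : ℕ) :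
    PowerSeries.coeff j (Y ^ k) ≠ ∞ := by
  obtain ⟨K, hK, hKle⟩ := PowerSeries.exists_coeff_pow_le h0 hY L
  exact ne_top_of_le_ne_top (ENNReal.mul_ne_top hK (by finiteness)) (hKle j hj hj k)

lemma isPgfIteration_iterate_pgfStep
    (hmom : ∑' k : ℕ, (k : ℝ≥0∞) ^ L * p₀ (k, false) ≠ ∞)
    (h0 : PowerSeries.coeff 0 Y ≤ 1) (hY : ∀ j ≤ L, PowerSeries.coeff j Y ≠ ∞) :
    IsPgfIteration (fun k => (p₀ (k, false)).toReal) L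
      (fun m k j => (PowerSeries.coeff j (((pgfStep p₀)^[m] Y) ^ k)).toReal) where
  coeff_nonneg := fun _ => ENNReal.toReal_nonneg
  summable := ENNReal.summable_toReal
    (ne_top_of_le_ne_top ENNReal.one_ne_top (tsum_pmf_false_le_one p₀))
  isConvPow := fun m => by
    obtain ⟨h0', hY'⟩ := coeff_iterate_pgfStep_ne_top hmom h0 hY m
    refine ⟨fun _ _ => ENNReal.toReal_nonneg, fun j => ?_, fun k j hj => ?_⟩
    · simp only [pow_zero, PowerSeries.coeff_one]
      split_ifs <;> simp
    · simp only [pow_one]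
      rw [pow_succ', PowerSeries.coeff_mul, ENNReal.toReal_sum fun x hx => ?_]
      · simp only [ENNReal.toReal_mul]
      · have := Finset.HasAntidiagonal.mem_antidiagonal.1 hx
        exact ENNReal.mul_ne_top (hY' _ (by omega))
          (PowerSeries.coeff_pow_ne_top h0' hY' (by omega) k)
  step := fun m j hj => by
    have h := (coeff_iterate_pgfStep_ne_top hmom h0 hY (m + 1)).2 j hj
    simp only [pow_one]
    rw [Function.iterate_succ_apply', pgfStep, PowerSeries.coeff_mk] at h ⊢
    have := ENNReal.hasSum_toReal h
    rw [← ENNReal.tsum_toReal_eq (ENNReal.ne_top_of_tsum_ne_top h)] at this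
    simpa only [ENNReal.toReal_mul] using this

end Finiteness

/-! ### The penalization as a power series coefficient. -/

section Penalty

/-- The power series `t (1 + X)`, whose powers generate the binomial coefficients. -/
noncomputable def penaltySeries (t : ℝ) : PowerSeries ℝ≥0∞ :=
  PowerSeries.C (ENNReal.ofReal t) * (1 + PowerSeries.X)

lemma coeff_penaltySeries_pow (t : ℝ) (k j : ℕ) :
    PowerSeries.coeff j (penaltySeries t ^ k) = ENNReal.ofReal t ^ k * (k.choose j : ℝ≥0∞) := by
  have h : (1 + PowerSeries.X : PowerSeries ℝ≥0∞) ^ k =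
      (((1 + Polynomial.X) ^ k : Polynomial ℝ≥0∞) : PowerSeries ℝ≥0∞) := by simp
  rw [penaltySeries, mul_pow, ← map_pow, PowerSeries.coeff_C_mul, h, Polynomial.coeff_coe,
    Polynomial.coeff_one_add_X_pow]

lemma hilbertH_natCast (ℓ k : ℕ) : hilbertH ℓ k = (k.choose ℓ : ℝ) := by
  rw [hilbertH, div_eq_iff (by positivity), ← Nat.cast_mul, mul_comm,
    ← Nat.descFactorial_eq_factorial_mul_choose, Nat.descFactorial_eq_prod_range]
  by_cases h : ℓ ≤ k
  · rw [Nat.cast_prod]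
    refine Finset.prod_congr rfl fun j hj => ?_
    rw [Nat.cast_sub (by have := Finset.mem_range.1 hj; omega)]
  -- For `k < ℓ` the real factors may be negative while natural subtraction truncates, but both
  -- products contain the zero factor `j = k`.
  · rw [Finset.prod_eq_zero (i := k) (by simpa using h) (sub_self _),
      Finset.prod_eq_zero (i := k) (by simpa using h) (Nat.sub_self _), Nat.cast_zero]

lemma penalty_eq_toReal {t : ℝ} (ht : 0 ≤ t) (ℓ m : ℕ) (τ : MarkedTree) :
    penalty ℓ t m τ = (unmarkedCoeff (penaltySeries t) m ℓ τ).toReal := by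
  rw [penalty, unmarkedCoeff, hilbertH_natCast, coeff_penaltySeries_pow]
  split_ifs
  · rw [ENNReal.toReal_mul, ENNReal.toReal_pow, ENNReal.toReal_ofReal ht, ENNReal.toReal_natCast]
    ring
  · simp

lemma setIntegral_toReal_unmarkedCoeff {p₀ : PMF (ℕ × Bool)} {X : PowerSeries ℝ≥0∞} {n j : ℕ}
    (h : ∀ k, PowerSeries.coeff j (X ^ k) ≠ ∞) (Λ : Set MarkedTree) :
    ∫ τ in Λ, (unmarkedCoeff X n j τ).toReal ∂(mgwLaw p₀) =
      (∫⁻ τ in Λ, unmarkedCoeff X n j τ ∂(mgwLaw p₀)).toReal := by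
  refine integral_toReal (measurable_unmarkedCoeff X n j).aemeasurable
    (Eventually.of_forall fun τ => ?_)
  unfold unmarkedCoeff
  split_ifs
  · exact (h _).lt_top
  · exact ENNReal.zero_lt_top

lemma toReal_markingLaw_false (p : PMF ℕ) (q : ℕ → unitInterval) (k : ℕ) :
    (markingLaw p q (k, false)).toReal = (p k).toReal * (1 - (q k : ℝ)) := by
  change (p k * ENNReal.ofReal (if false = true then (q k : ℝ) else 1 - q k)).toReal = _
  rw [ENNReal.toReal_mul, if_neg Bool.false_ne_true,
    ENNReal.toReal_ofReal (by linarith [(q k).2.2])]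

lemma markingLaw_false_le (p : PMF ℕ) (q : ℕ → unitInterval) (k : ℕ) :
    markingLaw p q (k, false) ≤ p k := by
  change p k * ENNReal.ofReal (if false = true then (q k : ℝ) else 1 - q k) ≤ _
  refine mul_le_of_le_one_right' ?_
  rw [if_neg Bool.false_ne_true, ENNReal.ofReal_le_one]
  linarith [(q k).2.1]

lemma tsum_markingLaw_false_lt_one {p : PMF ℕ} {q : ℕ → unitInterval}
    (hq : ∃ k, 0 < (p k).toReal * (q k : ℝ)) :
    ∑' k, (markingLaw p q (k, false)).toReal < 1 := by
  obtain ⟨k, hk⟩ := hq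
  have h1 : ∑' k, (p k).toReal = 1 := by
    rw [← ENNReal.tsum_toReal_eq p.apply_ne_top, p.tsum_coe, ENNReal.toReal_one]
  have hp : Summable fun k => (p k).toReal := ENNReal.summable_toReal p.tsum_coe_ne_top
  have hle : ∀ k, (markingLaw p q (k, false)).toReal ≤ (p k).toReal := fun k =>
    ENNReal.toReal_mono (p.apply_ne_top k) (markingLaw_false_le p q k)
  rw [← h1]
  refine Summable.tsum_lt_tsum (i := k) hle ?_
    (hp.of_nonneg_of_le (fun _ => ENNReal.toReal_nonneg) hle) hp
  rw [toReal_markingLaw_false]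
  linarith

/-- One step of the branching property, applied to the constant series `x`. -/
lemma psi_eq_tsum {p : PMF ℕ} {q : ℕ → unitInterval} {x : ℝ} (hx : x ∈ Icc (0 : ℝ) 1) :
    psi p q x = ∑' k, (markingLaw p q (k, false)).toReal * x ^ k := by
  have hcoeff : ∀ k, PowerSeries.coeff 0 (PowerSeries.C (ENNReal.ofReal x) ^ k) =
      ENNReal.ofReal x ^ k := fun k => by
    rw [← map_pow, PowerSeries.coeff_zero_C]
  have h : ∀ τ : MarkedTree, (if numMarks 1 τ = 0 then 1 else 0) * x ^ genSize 1 τ =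
      (unmarkedCoeff (PowerSeries.C (ENNReal.ofReal x)) 1 0 τ).toReal := by
    intro τ
    rw [unmarkedCoeff, hcoeff]
    split_ifs
    · rw [ENNReal.toReal_pow, ENNReal.toReal_ofReal hx.1, one_mul]
    · simp
  rw [psi]
  simp only [h]
  rw [mgwMeasure, ← setIntegral_univ, setIntegral_toReal_unmarkedCoeff
    (fun k => by rw [hcoeff]; finiteness), setLIntegral_univ, lintegral_unmarkedCoeff,
    Function.iterate_one, pgfStep, PowerSeries.coeff_mk]
  simp only [hcoeff]
  rw [ENNReal.tsum_toReal_eq fun k =>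
    ENNReal.mul_ne_top ((markingLaw p q).apply_ne_top _) (by finiteness)]
  refine tsum_congr fun k => ?_
  rw [ENNReal.toReal_mul, ENNReal.toReal_pow, ENNReal.toReal_ofReal hx.1]

end Penalty

/-! ### Passage to the limit in the penalized laws. -/

section Limit

lemma coeff_zero_penaltySeries_le_one {t : ℝ} (ht : t ≤ 1) :
    PowerSeries.coeff 0 (penaltySeries t) ≤ 1 := by
  have := coeff_penaltySeries_pow t 1 0
  simp only [pow_one, Nat.choose_zero_right, Nat.cast_one, mul_one] at this
  rw [this]
  exact ENNReal.ofReal_le_one.2 ht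

lemma coeff_penaltySeries_ne_top (t : ℝ) (j : ℕ) :
    PowerSeries.coeff j (penaltySeries t) ≠ ∞ := by
  have := coeff_penaltySeries_pow t 1 j
  rw [pow_one] at this
  rw [this]
  finiteness

lemma integral_penalty {p₀ : PMF (ℕ × Bool)} {t : ℝ} (ht : 0 ≤ t) (ℓ m : ℕ) :
    ∫ τ, penalty ℓ t m τ ∂(mgwLaw p₀) =
      (PowerSeries.coeff ℓ ((pgfStep p₀)^[m] (penaltySeries t))).toReal := by
  simp only [penalty_eq_toReal ht]
  rw [← setIntegral_univ, setIntegral_toReal_unmarkedCoeff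
    (fun k => by rw [coeff_penaltySeries_pow]; finiteness), setLIntegral_univ,
    lintegral_unmarkedCoeff]

lemma integrable_penalty {p₀ : PMF (ℕ × Bool)} {ℓ : ℕ}
    (hmom : ∑' k : ℕ, (k : ℝ≥0∞) ^ ℓ * p₀ (k, false) ≠ ∞) {t : ℝ} (ht : t ∈ Ioc (0 : ℝ) 1)
    (m : ℕ) : Integrable (penalty ℓ t m) (mgwLaw p₀) := by
  have h : penalty ℓ t m = fun τ => (unmarkedCoeff (penaltySeries t) m ℓ τ).toReal :=
    funext fun τ => penalty_eq_toReal ht.1.le ℓ m τ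
  rw [h]
  refine integrable_toReal_of_lintegral_ne_top (measurable_unmarkedCoeff _ _ _).aemeasurable ?_
  rw [lintegral_unmarkedCoeff]
  exact (coeff_iterate_pgfStep_ne_top hmom (coeff_zero_penaltySeries_le_one ht.2)
    (fun j _ => coeff_penaltySeries_ne_top t j) m).2 ℓ le_rfl

lemma setIntegral_penalty_add {p₀ : PMF (ℕ × Bool)} {ℓ : ℕ}
    (hmom : ∑' k : ℕ, (k : ℝ≥0∞) ^ ℓ * p₀ (k, false) ≠ ∞) {t : ℝ} (ht : t ∈ Ioc (0 : ℝ) 1)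
    (n m : ℕ) {Λ : Set MarkedTree} (hΛ : MeasurableSet[treeFiltration n] Λ) :
    ∫ τ in Λ, penalty ℓ t (n + m) τ ∂(mgwLaw p₀) = ∫ τ in Λ,
      (PowerSeries.coeff ℓ (((pgfStep p₀)^[m] (penaltySeries t)) ^ genSize n τ)).toReal *
        (if numMarks n τ = 0 then 1 else 0) ∂(mgwLaw p₀) := by
  obtain ⟨h0, hY⟩ := coeff_iterate_pgfStep_ne_top hmom (coeff_zero_penaltySeries_le_one ht.2)
    (fun j _ => coeff_penaltySeries_ne_top t j) m
  simp only [penalty_eq_toReal ht.1.le]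
  rw [setIntegral_toReal_unmarkedCoeff
    (fun k => by rw [coeff_penaltySeries_pow]; finiteness), setLIntegral_unmarkedCoeff_add _ _ _ _ _ hΛ,
    ← setIntegral_toReal_unmarkedCoeff (fun k => PowerSeries.coeff_pow_ne_top h0 hY le_rfl k)]
  refine integral_congr_ae (Eventually.of_forall fun τ => ?_)
  simp only [unmarkedCoeff]
  split_ifs <;> simp

lemma measurable_comp_genSize_mul (f : ℕ → ℝ) (n : ℕ) :
    Measurable[treeFiltration n] fun τ : MarkedTree =>
      f (genSize n τ) * (if numMarks n τ = 0 then 1 else 0) :=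
  measurable_treeFiltration fun τ => by
    simp only [genSize_restr le_rfl, numMarks_restr le_rfl]

/-- Convergence of the penalized laws, for a general bounded limit of the ratios. -/
lemma tendsto_setIntegral_penalty_div {p₀ : PMF (ℕ × Bool)} {ℓ : ℕ}
    (hmom : ∑' k : ℕ, (k : ℝ≥0∞) ^ ℓ * p₀ (k, false) ≠ ∞) {t : ℝ} (ht : t ∈ Ioc (0 : ℝ) 1)
    {c : ℕ → ℕ → ℕ → ℝ} (hc : c = fun m k j =>
      (PowerSeries.coeff j (((pgfStep p₀)^[m] (penaltySeries t)) ^ k)).toReal)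
    {φ : ℕ → ℝ} {K μ : ℝ} (hK : ∀ᶠ m in atTop, ∀ k, c m k ℓ / c m 1 ℓ ≤ K)
    (hφ : ∀ k, Tendsto (fun m => c m k ℓ / c m 1 ℓ) atTop (𝓝 (φ k)))
    (hpos : ∀ᶠ m in atTop, 0 < c m 1 ℓ) (hμ : ∑' k, (p₀ (k, false)).toReal * φ k = μ)
    (hμ0 : 0 < μ) (n : ℕ) {Λ : Set MarkedTree} (hΛ : MeasurableSet[treeFiltration n] Λ) :
    Tendsto (fun m : ℕ => (∫ τ in Λ, penalty ℓ t (n + m) τ ∂(mgwLaw p₀)) /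
      (∫ τ, penalty ℓ t (n + m) τ ∂(mgwLaw p₀))) atTop
      (𝓝 (∫ τ in Λ, φ (genSize n τ) / μ ^ n * (if numMarks n τ = 0 then 1 else 0)
        ∂(mgwLaw p₀))) := by
  subst hc
  set c : ℕ → ℕ → ℕ → ℝ := fun m k j =>
    (PowerSeries.coeff j (((pgfStep p₀)^[m] (penaltySeries t)) ^ k)).toReal with hc
  have hiter : IsPgfIteration _ ℓ c := isPgfIteration_iterate_pgfStep hmom
    (coeff_zero_penaltySeries_le_one ht.2) (fun j _ => coeff_penaltySeries_ne_top t j)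
  have hnn : ∀ m k, 0 ≤ c m k ℓ := fun m k => (hiter.isConvPow m).nonneg k ℓ
  have hratio := hiter.tendsto_add_div hK hφ hpos n
  rw [hμ] at hratio
  have hint : Tendsto (fun m => ∫ τ in Λ, c m (genSize n τ) ℓ / c m 1 ℓ *
      (if numMarks n τ = 0 then 1 else 0) ∂(mgwLaw p₀)) atTop
      (𝓝 (∫ τ in Λ, φ (genSize n τ) * (if numMarks n τ = 0 then 1 else 0) ∂(mgwLaw p₀))) := by
    refine tendsto_integral_filter_of_dominated_convergence (fun _ => K)
      (Eventually.of_forall fun m => ?_) ?_ (integrable_const K)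
      (Eventually.of_forall fun τ => (hφ _).mul_const _)
    · exact ((measurable_comp_genSize_mul (fun k => c m k ℓ / c m 1 ℓ) n).mono
        (treeFiltration.le n) le_rfl).aestronglyMeasurable
    · filter_upwards [hK] with m hm
      refine Eventually.of_forall fun τ => ?_
      have h0 : 0 ≤ c m (genSize n τ) ℓ / c m 1 ℓ := div_nonneg (hnn _ _) (hnn _ _)
      split_ifs
      · rw [mul_one, Real.norm_of_nonneg h0]
        exact hm _
      · rw [mul_zero, norm_zero]
        exact h0.trans (hm _)
  have hlim : ∫ τ in Λ, φ (genSize n τ) / μ ^ n * (if numMarks n τ = 0 then 1 else 0)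
      ∂(mgwLaw p₀) = (∫ τ in Λ, φ (genSize n τ) * (if numMarks n τ = 0 then 1 else 0)
        ∂(mgwLaw p₀)) / μ ^ n := by
    rw [← integral_div]
    exact integral_congr_ae (Eventually.of_forall fun τ => div_mul_eq_mul_div _ _ _)
  rw [hlim]
  -- Numerator and denominator have both been divided by `c m 1 ℓ`, which is eventually nonzero and
  -- cancels.
  refine (hint.div hratio (by positivity)).congr' ?_
  filter_upwards [hpos] with m hm
  have h1 : ∫ τ in Λ, c m (genSize n τ) ℓ / c m 1 ℓ *
      (if numMarks n τ = 0 then 1 else 0) ∂(mgwLaw p₀) =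
      (∫ τ in Λ, c m (genSize n τ) ℓ * (if numMarks n τ = 0 then 1 else 0) ∂(mgwLaw p₀)) /
        c m 1 ℓ := by
    rw [← integral_div]
    exact integral_congr_ae (Eventually.of_forall fun τ => div_mul_eq_mul_div _ _ _)
  have h2 : ∫ τ, penalty ℓ t (n + m) τ ∂(mgwLaw p₀) = c (n + m) 1 ℓ := by
    rw [integral_penalty ht.1.le, hc]
    simp only [pow_one]
  rw [Pi.div_apply, h1, h2, setIntegral_penalty_add hmom ht n m hΛ, div_div_div_cancel_right₀ hm.ne']

end Limit

/-! ### Uniqueness of the fixed point and the derivative there. -/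

section FixedPoint

variable {p : PMF ℕ} {q : ℕ → unitInterval}

lemma summable_toReal_markingLaw_false (p : PMF ℕ) (q : ℕ → unitInterval) :
    Summable fun k => (markingLaw p q (k, false)).toReal :=
  ENNReal.summable_toReal
    (ne_top_of_le_ne_top ENNReal.one_ne_top (tsum_pmf_false_le_one (markingLaw p q)))

/-- Under `r̃ = 0`, the generating function `ψ` has exactly one fixed point in `(0, 1]`. -/
lemma psiFixedPoints_eq_singleton (hq : ∃ k, 0 < (p k).toReal * (q k : ℝ))
    (hr : 0 < (p 0).toReal * (1 - (q 0 : ℝ))) :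
    psiFixedPoints p q = {kappaTilde p q} ∧ kappaTilde p q ∈ Ioo (0 : ℝ) 1 ∧
      ∑' k, (markingLaw p q (k, false)).toReal * kappaTilde p q ^ k = kappaTilde p q := by
  have hsum := summable_toReal_markingLaw_false p q
  have hnn : ∀ k, 0 ≤ (markingLaw p q (k, false)).toReal := fun _ => ENNReal.toReal_nonneg
  have hlt := tsum_markingLaw_false_lt_one hq
  obtain ⟨κ, hκ, hfix⟩ := exists_fixedPoint_tsum_mul_pow hnn hsum
    (by rwa [toReal_markingLaw_false]) hlt
  have hset : psiFixedPoints p q = {κ} := by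
    ext x
    simp only [psiFixedPoints, mem_ofPred_eq, mem_singleton_iff]
    constructor
    · rintro ⟨hx, hx'⟩
      rw [psi_eq_tsum ⟨hx.1.le, hx.2⟩] at hx'
      have h := abs_tsum_mul_pow_sub_le hnn hsum hκ hfix ⟨hx.1.le, hx.2⟩
      rw [hx'] at h
      -- A second fixed point `x` would satisfy `|x - κ| ≤ ρ |x - κ|` with `ρ < 1`.
      by_contra hne
      have h1 : 0 < |x - κ| := abs_pos.2 (sub_ne_zero.2 hne)
      have h2 : (∑' k, (markingLaw p q (k, false)).toReal - κ) / (1 - κ) < 1 := by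
        rw [div_lt_one (by linarith [hκ.2])]
        linarith
      nlinarith
    · rintro rfl
      exact ⟨⟨hκ.1, hκ.2.le⟩, by rw [psi_eq_tsum ⟨hκ.1.le, hκ.2.le⟩, hfix]⟩
  have hkt : kappaTilde p q = κ := by rw [kappaTilde, hset, csInf_singleton]
  rw [hkt]
  exact ⟨hset, hκ, hfix⟩

lemma hasDerivAt_psi {κ : ℝ} (hκ : κ ∈ Ioo (0 : ℝ) 1) :
    HasDerivAt (psi p q)
      (∑' k : ℕ, (markingLaw p q (k, false)).toReal * (k * κ ^ (k - 1))) κ := by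
  refine (hasDerivAt_tsum_mul_pow (fun _ => ENNReal.toReal_nonneg)
    (summable_toReal_markingLaw_false p q) hκ).congr_of_eventuallyEq ?_
  filter_upwards [Ioo_mem_nhds hκ.1 hκ.2] with x hx
  exact psi_eq_tsum ⟨hx.1.le, hx.2.le⟩

end FixedPoint

/-! ### Assembly of the two cases. -/

theorem mainTheorem7 (p : PMF ℕ) (q : ℕ → unitInterval)
    -- `p` is non-degenerate with finite mean
    (hp : p 0 + p 1 < 1) (hmean : ∑' k : ℕ, (k : ℝ≥0∞) * p k < ∞)
    -- marks occur with positive probability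
    (hq : ∃ k, 0 < (p k).toReal * (q k : ℝ))
    -- the case `r̃ = 0`
    (hr : 0 < (p 0).toReal * (1 - (q 0 : ℝ)))
    -- `p` has a moment of order `ℓ`
    (ℓ : ℕ) (hmom : ∑' k : ℕ, (k : ℝ≥0∞) ^ ℓ * p k < ∞)
    -- the penalization does not vanish identically at large times
    (hpen : ∃ k, min ℓ 2 ≤ k ∧ 0 < (p k).toReal * (1 - (q k : ℝ)))
    (t : ℝ) (ht : t ∈ Ioc (0 : ℝ) 1) :
    -- `κ̃` is the smallest positive fixed point of `ψ` and lies in `(0,1)`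
    (IsLeast (psiFixedPoints p q) (kappaTilde p q) ∧ kappaTilde p q < 1) ∧
    -- `ψ'(κ̃)` exists, and it is positive when `ℓ > 0`
    DifferentiableAt ℝ (psi p q) (kappaTilde p q) ∧
    (0 < ℓ → 0 < deriv (psi p q) (kappaTilde p q)) ∧
    -- the ratios are well defined at large times
    (∀ m, Integrable (penalty ℓ t m) (mgwMeasure p q)) ∧
    (∀ᶠ m in atTop, 0 < ∫ τ, penalty ℓ t m τ ∂(mgwMeasure p q)) ∧
    -- the limit is a martingale
    Martingale (limitMartingale p q ℓ) treeFiltration (mgwMeasure p q) ∧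
    -- the penalization limit
    ∀ (n : ℕ) (Λ : Set MarkedTree), MeasurableSet[treeFiltration n] Λ →
      Tendsto (fun m : ℕ =>
          (∫ τ in Λ, penalty ℓ t (n + m) τ ∂(mgwMeasure p q)) /
            (∫ τ, penalty ℓ t (n + m) τ ∂(mgwMeasure p q)))
        atTop (𝓝 (∫ τ in Λ, limitMartingale p q ℓ n τ ∂(mgwMeasure p q))) := by
  obtain ⟨hset, hκ, hfix⟩ := psiFixedPoints_eq_singleton hq hr
  have hderiv := hasDerivAt_psi (p := p) (q := q) hκ
  set κ := kappaTilde p q with hκdef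
  set a : ℕ → ℝ := fun k => (markingLaw p q (k, false)).toReal with ha
  set D := ∑' k : ℕ, a k * (k * κ ^ (k - 1)) with hD
  have hnn : ∀ k, 0 ≤ a k := fun _ => ENNReal.toReal_nonneg
  have hsum : Summable a := summable_toReal_markingLaw_false p q
  have hlt : ∑' k, a k < 1 := tsum_markingLaw_false_lt_one hq
  have hak : ∀ k, a k = (p k).toReal * (1 - (q k : ℝ)) := toReal_markingLaw_false p q
  have ha0 : 0 < a 0 := hak 0 ▸ hr
  have hpen' : ∃ k, min ℓ 2 ≤ k ∧ 0 < a k :=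
    hpen.imp fun k hk => ⟨hk.1, hak k ▸ hk.2⟩
  have hκ0 := hκ.1
  have hD0 : 0 < ℓ → 0 < D := by
    intro hℓ
    obtain ⟨k, hk, hak⟩ := hpen'
    -- For `ℓ > 0` the minimum is at least `1`, so the `k`-th term of the derivative series is
    -- positive.
    have hk1 : 0 < k := by omega
    refine (summable_mul_natCast_mul_pow_pred hnn hsum hκ.1.le hκ.2).tsum_pos
      (fun i => mul_nonneg (hnn i) (by positivity)) k (by positivity)
  have hD1 : D < 1 := (tsum_mul_natCast_mul_pow_pred_le hnn hsum hκ hfix).trans_lt (by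
    rw [div_lt_one (by linarith [hκ.2])]
    linarith)
  have hmom' : ∑' k : ℕ, (k : ℝ≥0∞) ^ ℓ * markingLaw p q (k, false) ≠ ∞ :=
    ((ENNReal.tsum_le_tsum fun k => by
      gcongr
      exact markingLaw_false_le p q k).trans_lt hmom).ne
  set c : ℕ → ℕ → ℕ → ℝ := fun m k j =>
    (PowerSeries.coeff j (((pgfStep (markingLaw p q))^[m] (penaltySeries t)) ^ k)).toReal with hc
  have hiter : IsPgfIteration a ℓ c := isPgfIteration_iterate_pgfStep hmom'
    (coeff_zero_penaltySeries_le_one ht.2) (fun j _ => coeff_penaltySeries_ne_top t j)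
  have hc0 : ∀ j, c 0 1 j = t * (Nat.choose 1 j : ℝ) := fun j => by
    change (PowerSeries.coeff j (penaltySeries t ^ 1)).toReal = _
    rw [coeff_penaltySeries_pow, pow_one, ENNReal.toReal_mul, ENNReal.toReal_ofReal ht.1.le,
      ENNReal.toReal_natCast]
  have hc00 : c 0 1 0 = t := by simp [hc0]
  have hc01 : c 0 1 1 = t := by simp [hc0]
  have hpos : ∀ᶠ m in atTop, 0 < c m 1 ℓ :=
    hiter.eventually_one_pos ha0 (hc00 ▸ ht.1) (hc01 ▸ ht.1) hpen'
  have htend := hiter.tendsto_one_zero hκ hfix hlt (hc00 ▸ ht.2)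
  -- Both cases fit one scheme: `φ k = κ ^ (k - 1)`, `μ = 1` for `ℓ = 0`, and `φ k = k κ ^ (k - 1)`,
  -- `μ = D` for `ℓ > 0`.
  obtain ⟨φ, μ, K, hμ0, hK, hφ, hμ, hlim⟩ : ∃ (φ : ℕ → ℝ) (μ K : ℝ), 0 < μ ∧
      (∀ᶠ m in atTop, ∀ k, c m k ℓ / c m 1 ℓ ≤ K) ∧
      (∀ k, Tendsto (fun m => c m k ℓ / c m 1 ℓ) atTop (𝓝 (φ k))) ∧
      ∑' k, a k * φ k = μ ∧ ∀ n, limitMartingale p q ℓ n = fun τ =>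
        φ (genSize n τ) / μ ^ n * (if numMarks n τ = 0 then 1 else 0) := by
    rcases Nat.eq_zero_or_pos ℓ with rfl | hℓ
    · obtain ⟨⟨K, hK⟩, hφ⟩ := hiter.tendsto_div_of_pos_of_eq_zero hκ.1 hκ.2 htend
      refine ⟨fun k => κ ^ ((k : ℤ) - 1), 1, K, one_pos, hK, hφ, ?_, fun n => ?_⟩
      · have h : ∀ k : ℕ, a k * κ ^ ((k : ℤ) - 1) = a k * κ ^ k / κ := fun k => by
          rw [zpow_sub₀ hκ.1.ne', zpow_natCast, zpow_one, mul_div_assoc]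
        simp only [h]
        rw [tsum_div_const, hfix, div_self hκ.1.ne']
      · funext τ
        rw [limitMartingale, if_pos rfl, one_pow, div_one]
    · obtain ⟨⟨K, hK⟩, hφ⟩ := hiter.tendsto_div_of_pos hℓ hκ.2 htend (hD0 hℓ) hD1 hpos
      refine ⟨fun k => k * κ ^ (k - 1), D, K, hD0 hℓ, hK, hφ, rfl, fun n => ?_⟩
      funext τ
      rw [limitMartingale, if_neg hℓ.ne', hderiv.deriv]
      congr 2
      -- Integer and truncated exponents differ only for an extinct generation, where the factor
      -- `Z_n` vanishes.
      rcases genSize n τ with _ | k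
      · simp
      · push_cast
        rw [add_sub_cancel_right, zpow_natCast]
  have hlimit : ∀ (n : ℕ) (Λ : Set MarkedTree), MeasurableSet[treeFiltration n] Λ →
      Tendsto (fun m : ℕ =>
          (∫ τ in Λ, penalty ℓ t (n + m) τ ∂(mgwMeasure p q)) /
            (∫ τ, penalty ℓ t (n + m) τ ∂(mgwMeasure p q)))
        atTop (𝓝 (∫ τ in Λ, limitMartingale p q ℓ n τ ∂(mgwMeasure p q))) := by
    intro n Λ hΛ
    rw [hlim]
    exact tendsto_setIntegral_penalty_div hmom' ht hc hK hφ hpos hμ hμ0 n hΛ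
  have hφ0 : ∀ k, 0 ≤ φ k := fun k => ge_of_tendsto' (hφ k) fun m =>
    div_nonneg ((hiter.isConvPow m).nonneg _ _) ((hiter.isConvPow m).nonneg _ _)
  have hφK : ∀ k, φ k ≤ K := fun k => le_of_tendsto (hφ k) (hK.mono fun m hm => hm k)
  have hmeas : ∀ n, Measurable[treeFiltration n] (limitMartingale p q ℓ n) := fun n => by
    rw [hlim]
    exact measurable_comp_genSize_mul (fun k => φ k / μ ^ n) n
  refine ⟨⟨⟨?_, ?_⟩, hκ.2⟩, hderiv.differentiableAt, fun hℓ => hderiv.deriv ▸ hD0 hℓ,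
    integrable_penalty hmom' ht, ?_, ?_, hlimit⟩
  · rw [hset]
    exact mem_singleton κ
  · rw [hset]
    rintro x rfl
    exact le_rfl
  · filter_upwards [hpos] with m hm
    rw [mgwMeasure, integral_penalty ht.1.le]
    simpa only [hc, pow_one] using hm
  · refine martingale_of_setIntegral_eq_succ (fun n => (hmeas n).stronglyMeasurable)
      (fun n => ?_) fun n Λ hΛ => ?_
    · refine Integrable.of_bound
        ((hmeas n).mono (treeFiltration.le n) le_rfl).aestronglyMeasurable (K / μ ^ n)
        (Eventually.of_forall fun τ => ?_)
      simp only [hlim]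
      have h0 : 0 ≤ φ (genSize n τ) / μ ^ n := div_nonneg (hφ0 _) (by positivity)
      have h1 : φ (genSize n τ) / μ ^ n ≤ K / μ ^ n := by
        gcongr
        exact hφK _
      split_ifs
      · rw [mul_one, Real.norm_of_nonneg h0]
        exact h1
      · rw [mul_zero, norm_zero]
        exact h0.trans h1
    -- An event of `ℱ_n` also lies in `ℱ_{n+1}`; shifting the first sequence by one gives the
    -- second, so uniqueness of limits equates the two integrals.
    · have h1 := (hlimit n Λ hΛ).comp (tendsto_add_atTop_nat 1)
      have h2 := hlimit (n + 1) Λ (treeFiltration.mono (Nat.le_succ n) _ hΛ)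
      refine tendsto_nhds_unique h1 (h2.congr fun m => ?_)
      simp only [Function.comp_apply, add_assoc, add_comm 1 m]
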